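/- Let $E=(0,1)$, let $d\mu(x)=dx/\sqrt{x(1-x)}$ on $E$, and for an integer $k\ge 0$ let $H^k_\mu(E)$ be the space of real functions $g$ on $E$ whose weak derivatives $D^jg$, $0\le j\le k$, exist and lie in $L^2_\mu(E)$, with norm $\|g\|_{H^k_\mu(E)}=\sum_{j=0}^k\|D^jg\|_{L^2_\mu(E)}$. Let $\overline P_n(x)=\sqrt{2n+1}\,P_n(2x-1)$, where $P_n$ is the $n$-th Legendre polynomial. Let $f\in L^2(E)$ be real-valued, let $$g(x)=(Af)(x)=\int_0^x\frac{f(y)}{\sqrt{x-y}}\,dy$$ (for almost every $x\in E$) be its Abel transform, and for an integer $N\ge 1$ let $$f_N=\sum_{n=0}^N c_n\overline P_n,\qquad c_n=\int_0^1 f(x)\,\overline P_n(x)\,dx .$$ Let $k>1$ be an integer. If $g\in H^k_\mu(E)$ and $$\lim_{t\to 0}D_t^j\left[g\left(\sin^2\tfrac t2\right)\right]=0\qquad (j=0,1,\dots,k-1),$$ where $D_t^j$ denotes the weak derivative on $(-\pi,\pi)\setminus\{0\}$ and the limit is an essential limit (that is, up to Lebesgue-null sets), then $$\|f-f_N\|_{L^2(E)}\le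 q_5(k)\,\frac{\|g\|_{H^k_\mu(E)}}{N^{k-1}},$$ where $q_5(k)=q_2(k)\,q_3(k)\,q_4(k)$ with $$q_2(k)=2\pi\binom{k}{\lfloor k/2\rfloor},\qquad q_3(k)=\sqrt{\frac{3}{2(k-1)}},\qquad q_4(k)=\frac{\sqrt{2(k+1)}\,(k!)^2}{\pi}.$$ -/

import Mathlib

open MeasureTheory Set Filter Topology
open scoped ContDiff

noncomputable section

namespace AbelInversion

/-- The open interval `E = (0, 1)`. -/
def E : Set ℝ := Ioo 0 1

/-- The norm of `L²(E)` with respect to Lebesgue measure. -/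
def normL2 (u : ℝ → ℝ) : ℝ := (eLpNorm u 2 (volume.restrict E)).toReal

/-- The measure `dμ(x) = dx / √(x (1 - x))` on `E`. -/
def mu : Measure ℝ :=
  (volume.restrict E).withDensity fun x => ENNReal.ofReal (1 / √(x * (1 - x)))

/-- The norm of `L²_μ(E)`. -/
def normL2mu (u : ℝ → ℝ) : ℝ := (eLpNorm u 2 mu).toReal

/-- The Abel transform `(A f)(x) = ∫₀ˣ f(y) / √(x - y) dy`. -/
def abelTransform (f : ℝ → ℝ) (x : ℝ) : ℝ := ∫ y in (0 : ℝ)..x, f y / √(x - y)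

/-- The Legendre polynomial `P_n`, by the formula of Rodrigues
`P_n(x) = (1 / (2ⁿ n!)) dⁿ/dxⁿ (x² - 1)ⁿ`. -/
def legendreP (n : ℕ) : Polynomial ℝ :=
  Polynomial.C (1 / (2 ^ n * (n.factorial : ℝ))) *
    Polynomial.derivative^[n] ((Polynomial.X ^ 2 - 1) ^ n)

/-- The normalized shifted Legendre polynomial `√(2n+1) P_n(2x - 1)`. -/
def shiftedP (n : ℕ) (x : ℝ) : ℝ := √(2 * n + 1) * (legendreP n).eval (2 * x - 1)

/-- The Legendre coefficient `c_n = ∫₀¹ f(x) P̄_n(x) dx`. -/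
def legendreCoeff (f : ℝ → ℝ) (n : ℕ) : ℝ := ∫ x in (0 : ℝ)..1, f x * shiftedP n x

/-- The truncated Legendre expansion `f_N = ∑_{n=0}^N c_n P̄_n`. -/
def legendrePartialSum (f : ℝ → ℝ) (N : ℕ) (x : ℝ) : ℝ :=
  ∑ n ∈ Finset.range (N + 1), legendreCoeff f n * shiftedP n x

/-- `w` is a weak derivative of order `j` of `u` on the open set `U`. -/
structure IsWeakDeriv (U : Set ℝ) (j : ℕ) (u w : ℝ → ℝ) : Prop where
  locInt_left : LocallyIntegrableOn u U
  locInt_right : LocallyIntegrableOn w U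
  integral_eq : ∀ φ : ℝ → ℝ, ContDiff ℝ ∞ φ → HasCompactSupport φ → tsupport φ ⊆ U →
    ∫ x in U, u x * iteratedDeriv j φ x = (-1) ^ j * ∫ x in U, w x * φ x

open Classical in
/-- The weak derivative `D^j u` on `U` (some representative of it; zero if it does not exist). -/
def weakDeriv (U : Set ℝ) (j : ℕ) (u : ℝ → ℝ) : ℝ → ℝ :=
  if h : ∃ w, IsWeakDeriv U j u w then h.choose else 0

/-- Weak derivatives are unique up to null sets. -/
theorem IsWeakDeriv.ae_eq {U : Set ℝ} (hU : IsOpen U) {j : ℕ} {u w₁ w₂ : ℝ → ℝ}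
    (h₁ : IsWeakDeriv U j u w₁) (h₂ : IsWeakDeriv U j u w₂) :
    w₁ =ᵐ[volume.restrict U] w₂ := by
  have key := hU.ae_eq_zero_of_integral_contDiff_smul_eq_zero (μ := volume)
    (f := fun x => w₁ x - w₂ x) (h₁.locInt_right.sub h₂.locInt_right) ?_
  · rw [Filter.EventuallyEq, ae_restrict_iff' hU.measurableSet]
    filter_upwards [key] with x hx hxU
    exact sub_eq_zero.mp (hx hxU)
  · intro φ hφ hc hs
    have e := (h₁.integral_eq φ hφ hc hs).symm.trans (h₂.integral_eq φ hφ hc hs)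
    have e' : ∫ x in U, w₁ x * φ x = ∫ x in U, w₂ x * φ x :=
      mul_left_cancel₀ (pow_ne_zero _ (by norm_num)) e
    have hint : ∀ w : ℝ → ℝ, LocallyIntegrableOn w U →
        Integrable (fun x => w x * φ x) (volume.restrict U) := by
      intro w hw
      have hK : IntegrableOn w (tsupport φ) := hw.integrableOn_compact_subset hs hc
      have := hK.mul_continuousOn hφ.continuous.continuousOn hc
      refine (this.integrable_of_forall_notMem_eq_zero ?_).integrableOn
      intro x hx
      simp [image_eq_zero_of_notMem_tsupport hx]
    have hsupp : Function.support (fun x => φ x • (w₁ x - w₂ x)) ⊆ U := by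
      intro x hx
      by_contra hxU
      exact hx (by simp [image_eq_zero_of_notMem_tsupport fun h => hxU (hs h)])
    rw [← setIntegral_eq_integral_of_forall_compl_eq_zero (s := U)
      (fun x hx => Function.notMem_support.mp fun h => hx (hsupp h))]
    have : ∀ x, φ x • (w₁ x - w₂ x) = w₁ x * φ x - w₂ x * φ x := by
      intro x; simp only [smul_eq_mul]; ring
    simp_rw [this]
    rw [integral_sub (hint _ h₁.locInt_right) (hint _ h₂.locInt_right), e', sub_self]

/-- The representative chosen in `weakDeriv` is the weak derivative, whenever there is one. -/
theorem IsWeakDeriv.weakDeriv_ae_eq {U : Set ℝ} (hU : IsOpen U) {j : ℕ} {u w : ℝ → ℝ}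
    (h : IsWeakDeriv U j u w) : weakDeriv U j u =ᵐ[volume.restrict U] w := by
  have hex : ∃ w, IsWeakDeriv U j u w := ⟨w, h⟩
  have : IsWeakDeriv U j u (weakDeriv U j u) := by
    rw [weakDeriv, dif_pos hex]; exact hex.choose_spec
  exact this.ae_eq hU h

/-- Membership in the weighted Sobolev space `H^k_μ(E)`: the weak derivatives of orders
`0, …, k` exist on `E` and lie in `L²_μ(E)`. -/
def MemSobolev (k : ℕ) (u : ℝ → ℝ) : Prop :=
  ∀ j ≤ k, ∃ w, IsWeakDeriv E j u w ∧ MemLp w 2 mu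

/-- The norm `‖u‖ = ∑_{j=0}^k ‖D^j u‖_{L²_μ(E)}` of `H^k_μ(E)`. -/
def sobolevNorm (k : ℕ) (u : ℝ → ℝ) : ℝ :=
  ∑ j ∈ Finset.range (k + 1), normL2mu (weakDeriv E j u)

/-- The conditions `lim_{t → 0} D_t^j [g(sin²(t/2))] = 0` for `j = 0, …, k-1`. Here `D_t^j` is the
weak derivative on the punctured interval `(-π, π) ∖ {0}`; since it is a function up to null sets,
the limit is taken along the filter of almost all `t ≠ 0` close to `0`. -/
def VanishesAtZero (k : ℕ) (g : ℝ → ℝ) : Prop :=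
  ∀ j < k, ∃ w : ℝ → ℝ,
    IsWeakDeriv (Ioo (-Real.pi) Real.pi \ {0}) j (fun t => g (Real.sin (t / 2) ^ 2)) w ∧
      Tendsto w (𝓝[≠] 0 ⊓ ae volume) (𝓝 0)

/-- `q₂(k) = 2π binom(k, ⌊k/2⌋)`. -/
def q₂ (k : ℕ) : ℝ := 2 * Real.pi * (k.choose (k / 2) : ℝ)

/-- `q₃(k) = √(3 / (2 (k - 1)))`. -/
def q₃ (k : ℕ) : ℝ := √(3 / (2 * ((k : ℝ) - 1)))

/-- `q₄(k) = √(2 (k + 1)) (k!)² / π`. -/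
def q₄ (k : ℕ) : ℝ := √(2 * ((k : ℝ) + 1)) * (k.factorial : ℝ) ^ 2 / Real.pi

/-- `q₅(k) = q₂(k) q₃(k) q₄(k)`. -/
def q₅ (k : ℕ) : ℝ := q₂ k * q₃ k * q₄ k

end AbelInversion

end

/-! The Legendre coefficients of `f` are sine coefficients of its Abel transform. By the
Mehler–Dirichlet formula the shifted Legendre polynomial is an Abel-type integral of a sine.
Inserting this into `c_n` and exchanging the integrals makes `A f` appear, and with `x = sin² (t /
2)` one gets (`legendreCoeff_eq_integral_sin`) `c_n = (-1)ⁿ √(2n+1) / π * ∫₀^π g(sin² (t/2)) sin ((n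
+ 1/2) t) dt`.

Smoothness of `g` now gives decay, through `k` integrations by parts. The boundary terms at `0`
vanish by hypothesis. Those at `π` vanish alternately: either the iterated primitive of the sine is
zero there, or an odd derivative of `g(sin² (t/2))` is, since this function is symmetric about `π`
(`abs_integral_mul_sin_le`).

What remains is the `L¹(0, π)` norm of the `k`-th derivative in `t`. The chain rule expresses it
through the `D^j g` with trigonometric coefficients of modulus at most `k!` (`abs_chainCoeff_le`).
The substitution carries `dt` to `μ` (`measurePreserving_sinSq`), so Cauchy–Schwarz bounds it by `k!
√π ‖g‖`. Hence `|c_n| ≤ √(2n+1) (k!/√π) ‖g‖ / (n + 1/2)^k`.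

Parseval in the Legendre basis and a telescoping tail estimate (`normL2_sub_partialSum_le`,
`sum_sq_le_of_decay`) give the rate `N^{-(k-1)}` with the constant `k!/√π`, which is at most `q₅ k`
(`factorial_div_sqrt_pi_le_q₅`).

The regularity is handled by a representative `γ` of `g` of class `C^{k-1}` whose last derivative is
a primitive of an integrable function (`exists_contDiff_representative`, `IsPrimitive`). -/

noncomputable section

namespace AbelInversion

/-! ### Shifted Legendre polynomials: Rodrigues' formula and orthonormality -/

section Legendre

open Polynomial

/-- The shifted Legendre polynomial of Mathlib, with real coefficients. -/
def realShiftedLegendre (n : ℕ) : ℝ[X] := (shiftedLegendre n).map (Int.castRingHom ℝ)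

theorem iterate_derivative_comp_two_mul_X_sub_one (p : ℝ[X]) (n : ℕ) :
    derivative^[n] (p.comp (2 * X - 1)) = C (2 ^ n) * (derivative^[n] p).comp (2 * X - 1) := by
  induction n with
  | zero => simp
  | succ n ih =>
    rw [Function.iterate_succ_apply', ih, Function.iterate_succ_apply', derivative_C_mul,
      derivative_comp]
    have : derivative (2 * X - 1 : ℝ[X]) = C 2 := by
      rw [show (2 : ℝ[X]) = C 2 from rfl]
      simp
    rw [this, pow_succ, C_mul]
    ring

theorem factorial_mul_realShiftedLegendre (n : ℕ) :
    C (n.factorial : ℝ) * realShiftedLegendre n = derivative^[n] ((X * (1 - X)) ^ n) := by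
  have h := congrArg (Polynomial.map (Int.castRingHom ℝ)) (factorial_mul_shiftedLegendre_eq n)
  rw [Polynomial.map_mul, ← iterate_derivative_map] at h
  simpa [realShiftedLegendre, mul_pow] using h

/-- Both sides come from Rodrigues' formula: `x² - 1` at `2x - 1` is `-4x(1 - x)`, and the chain
rule costs `2ⁿ`, so that of `(-4)ⁿ` only the sign survives the normalization. -/
theorem legendreP_comp (n : ℕ) :
    (legendreP n).comp (2 * X - 1) = C ((-1) ^ n) * realShiftedLegendre n := by
  have h1 := iterate_derivative_comp_two_mul_X_sub_one ((X ^ 2 - 1) ^ n) n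
  have h2 : ((X ^ 2 - 1 : ℝ[X]) ^ n).comp (2 * X - 1) = C ((-4) ^ n) * (X * (1 - X)) ^ n := by
    rw [pow_comp, C_pow, ← mul_pow]
    congr 1
    rw [show (-4 : ℝ) = -(2 * 2) by norm_num, C_neg, C_mul, show (C 2 : ℝ[X]) = 2 from rfl]
    simp
    ring
  rw [h2, iterate_derivative_C_mul, ← factorial_mul_realShiftedLegendre] at h1
  have h3 : (derivative^[n] ((X ^ 2 - 1 : ℝ[X]) ^ n)).comp (2 * X - 1)
      = C ((-2) ^ n * (n.factorial : ℝ)) * realShiftedLegendre n := by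
    have h2n : (2 : ℝ) ^ n ≠ 0 := by positivity
    have : C ((2 : ℝ) ^ n) * (derivative^[n] ((X ^ 2 - 1 : ℝ[X]) ^ n)).comp (2 * X - 1)
        = C ((2 : ℝ) ^ n) * (C ((-2) ^ n * (n.factorial : ℝ)) * realShiftedLegendre n) := by
      rw [← h1, ← mul_assoc, ← mul_assoc, ← C_mul, ← C_mul, ← mul_assoc, ← mul_pow]
      norm_num
    exact mul_left_cancel₀ (C_ne_zero.mpr h2n) this
  rw [legendreP, mul_comp, C_comp, h3, ← mul_assoc, ← C_mul]
  congr 2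
  have : (n.factorial : ℝ) ≠ 0 := by positivity
  field_simp
  rw [← mul_pow]
  norm_num

theorem shiftedP_eq (n : ℕ) (x : ℝ) :
    shiftedP n x = √(2 * n + 1) * ((-1) ^ n * (realShiftedLegendre n).eval x) := by
  have h := congrArg (Polynomial.eval x) (legendreP_comp n)
  simp only [eval_comp, eval_mul, eval_sub, eval_X, eval_one, eval_C, eval_ofNat] at h
  rw [shiftedP, h]

theorem continuous_shiftedP (n : ℕ) : Continuous (shiftedP n) := by
  unfold shiftedP
  fun_prop

theorem realShiftedLegendre_eval_one_sub (n : ℕ) (x : ℝ) :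
    (-1) ^ n * (realShiftedLegendre n).eval x = (realShiftedLegendre n).eval (1 - x) := by
  have h := shiftedLegendre_eval_symm n (1 - x)
  rw [sub_sub_cancel] at h
  simp only [realShiftedLegendre, eval_map]
  simpa [aeval_def] using h.symm

theorem coeff_realShiftedLegendre (n k : ℕ) :
    (realShiftedLegendre n).coeff k = (-1) ^ k * n.choose k * (n + k).choose n := by
  rw [realShiftedLegendre, coeff_map, coeff_shiftedLegendre]
  simp

theorem natDegree_realShiftedLegendre (n : ℕ) : (realShiftedLegendre n).natDegree = n := by
  rw [realShiftedLegendre, natDegree_map_eq_of_injective (RingHom.injective_int _),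
    natDegree_shiftedLegendre]

theorem intervalIntegrable_eval (p : ℝ[X]) (a b : ℝ) :
    IntervalIntegrable (fun x => p.eval x) volume a b :=
  p.continuous.intervalIntegrable a b

theorem integral_derivative_mul (p q : ℝ[X]) (h0 : p.eval 0 = 0) (h1 : p.eval 1 = 0) :
    ∫ x in (0 : ℝ)..1, (derivative p).eval x * q.eval x
      = -∫ x in (0 : ℝ)..1, p.eval x * (derivative q).eval x := by
  have h := intervalIntegral.integral_mul_deriv_eq_deriv_mul
    (fun x _ => q.hasDerivAt x) (fun x _ => p.hasDerivAt x)
    (intervalIntegrable_eval (derivative q) 0 1) (intervalIntegrable_eval (derivative p) 0 1)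
  simp only [h0, h1, mul_zero, sub_zero, zero_sub] at h
  rw [show (∫ x in (0 : ℝ)..1, (derivative p).eval x * q.eval x)
    = ∫ x in (0 : ℝ)..1, q.eval x * (derivative p).eval x by simp_rw [mul_comm], h]
  simp_rw [mul_comm]

theorem integral_iterate_derivative_mul (p q : ℝ[X]) (n : ℕ)
    (h0 : ∀ j < n, (derivative^[j] p).eval 0 = 0) (h1 : ∀ j < n, (derivative^[j] p).eval 1 = 0) :
    ∫ x in (0 : ℝ)..1, (derivative^[n] p).eval x * q.eval x
      = (-1) ^ n * ∫ x in (0 : ℝ)..1, p.eval x * (derivative^[n] q).eval x := by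
  induction n generalizing q with
  | zero => simp
  | succ n ih =>
    rw [Function.iterate_succ_apply', integral_derivative_mul _ _ (h0 n (by simp)) (h1 n (by simp)),
      ih (derivative q) (fun j hj => h0 j (by omega)) (fun j hj => h1 j (by omega)),
      Function.iterate_succ_apply]
    ring

/-- The Beta integral: each integration by parts trades a factor `1 - x` for a factor `x`. -/
theorem integral_pow_mul_one_sub_pow (a b : ℕ) :
    ∫ x in (0 : ℝ)..1, x ^ a * (1 - x) ^ b
      = (a.factorial : ℝ) * b.factorial / (a + b + 1).factorial := by
  induction b generalizing a with
  | zero =>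
    simp only [pow_zero, mul_one, integral_pow, Nat.factorial_zero, add_zero, Nat.factorial_succ]
    have : (a.factorial : ℝ) ≠ 0 := by positivity
    push_cast
    field_simp
    simp
  | succ b ih =>
    have h := intervalIntegral.integral_mul_deriv_eq_deriv_mul (a := 0) (b := 1)
      (u := fun x : ℝ => (1 - x) ^ (b + 1)) (u' := fun x : ℝ => -((b + 1) * (1 - x) ^ b))
      (v := fun x : ℝ => x ^ (a + 1) / (a + 1)) (v' := fun x : ℝ => x ^ a)
      (fun x _ => by
        have := ((hasDerivAt_id x).const_sub 1).pow (b + 1)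
        convert! this using 1
        simp)
      (fun x _ => by
        have := (hasDerivAt_pow (a + 1) x).div_const ((a : ℝ) + 1)
        convert! this using 1
        have : (a : ℝ) + 1 ≠ 0 := by positivity
        simp
        field_simp)
      (by apply Continuous.intervalIntegrable; fun_prop)
      (by apply Continuous.intervalIntegrable; fun_prop)
    simp only [sub_self, ne_eq, Nat.add_eq_zero_iff, one_ne_zero, and_false, not_false_eq_true,
      zero_pow, zero_mul, zero_div, mul_zero, zero_sub] at h
    rw [show (∫ x in (0 : ℝ)..1, x ^ a * (1 - x) ^ (b + 1))
      = ∫ x in (0 : ℝ)..1, (1 - x) ^ (b + 1) * x ^ a by congr 1; ext x; ring, h,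
      ← intervalIntegral.integral_neg]
    rw [show (∫ x in (0 : ℝ)..1, -(-((b + 1) * (1 - x) ^ b) * (x ^ (a + 1) / (a + 1))))
      = ∫ x in (0 : ℝ)..1, ((b + 1) / (a + 1) : ℝ) * (x ^ (a + 1) * (1 - x) ^ b) by
        congr 1; ext x; ring, intervalIntegral.integral_const_mul, ih (a + 1),
      show a + 1 + b + 1 = a + (b + 1) + 1 by ring, Nat.factorial_succ a, Nat.factorial_succ b]
    have : (a : ℝ) + 1 ≠ 0 := by positivity
    push_cast
    field_simp

theorem iterate_derivative_eval_zero (n j : ℕ) (hj : j < n) (x : ℝ) (hx : x * (1 - x) = 0) :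
    (derivative^[j] ((X * (1 - X) : ℝ[X]) ^ n)).eval x = 0 := by
  obtain ⟨q, hq⟩ := pow_sub_dvd_iterate_derivative_pow (X * (1 - X) : ℝ[X]) n j
  have : n - j ≠ 0 := by omega
  rw [hq]
  simp [hx, this]

/-- Rodrigues' formula and `n` integrations by parts; the boundary terms vanish because `x(1 - x)`
divides all derivatives of its `n`-th power of order below `n`. Orthogonality and normalization both
follow from this identity. -/
theorem integral_realShiftedLegendre_mul (n : ℕ) (q : ℝ[X]) :
    (n.factorial : ℝ) * ∫ x in (0 : ℝ)..1, (realShiftedLegendre n).eval x * q.eval x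
      = (-1) ^ n * ∫ x in (0 : ℝ)..1, (x * (1 - x)) ^ n * (derivative^[n] q).eval x := by
  have h := integral_iterate_derivative_mul ((X * (1 - X) : ℝ[X]) ^ n) q n
    (fun j hj => iterate_derivative_eval_zero n j hj 0 (by simp))
    (fun j hj => iterate_derivative_eval_zero n j hj 1 (by simp))
  rw [← factorial_mul_realShiftedLegendre] at h
  simp only [eval_mul, eval_C, mul_assoc, intervalIntegral.integral_const_mul] at h
  rw [h]
  simp

theorem integral_realShiftedLegendre_mul_eq_zero (n : ℕ) (q : ℝ[X]) (hq : q.natDegree < n) :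
    ∫ x in (0 : ℝ)..1, (realShiftedLegendre n).eval x * q.eval x = 0 := by
  have h := integral_realShiftedLegendre_mul n q
  rw [iterate_derivative_eq_zero hq] at h
  have : (n.factorial : ℝ) ≠ 0 := by positivity
  simpa [this] using h

theorem iterate_derivative_realShiftedLegendre (n : ℕ) (x : ℝ) :
    (derivative^[n] (realShiftedLegendre n)).eval x
      = (-1) ^ n * ((2 * n).factorial : ℝ) / n.factorial := by
  have hdeg : (derivative^[n] (realShiftedLegendre n)).natDegree ≤ 0 := by
    have := natDegree_iterate_derivative (realShiftedLegendre n) n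
    rw [natDegree_realShiftedLegendre] at this
    omega
  rw [eq_C_of_natDegree_le_zero hdeg, eval_C, coeff_iterate_derivative, zero_add,
    coeff_realShiftedLegendre, Nat.descFactorial_self, nsmul_eq_mul, ← two_mul,
    Nat.choose_self, Nat.cast_choose ℝ (by omega : n ≤ 2 * n), show 2 * n - n = n by omega]
  have : (n.factorial : ℝ) ≠ 0 := by positivity
  push_cast
  field_simp

theorem integral_realShiftedLegendre_sq (n : ℕ) :
    ∫ x in (0 : ℝ)..1, (realShiftedLegendre n).eval x * (realShiftedLegendre n).eval x
      = 1 / (2 * n + 1) := by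
  have h := integral_realShiftedLegendre_mul n (realShiftedLegendre n)
  simp only [iterate_derivative_realShiftedLegendre, mul_pow, intervalIntegral.integral_mul_const,
    integral_pow_mul_one_sub_pow] at h
  have h1 : (n.factorial : ℝ) ≠ 0 := by positivity
  have h2 : ((2 * n).factorial : ℝ) ≠ 0 := by positivity
  rw [← two_mul, Nat.factorial_succ] at h
  refine mul_left_cancel₀ h1 (h.trans ?_)
  have h3 : ((-1 : ℝ) ^ n) * (-1) ^ n = 1 := by rw [← mul_pow]; norm_num
  push_cast
  field_simp
  linear_combination h3

theorem integral_shiftedP_mul_shiftedP (m n : ℕ) :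
    ∫ x in (0 : ℝ)..1, shiftedP m x * shiftedP n x = if m = n then 1 else 0 := by
  have hlt : ∀ m n : ℕ, n < m → ∫ x in (0 : ℝ)..1, shiftedP m x * shiftedP n x = 0 := by
    intro m n hmn
    have h := integral_realShiftedLegendre_mul_eq_zero m (realShiftedLegendre n)
      (by rwa [natDegree_realShiftedLegendre])
    have e : ∀ x, shiftedP m x * shiftedP n x = (√(2 * m + 1) * (-1) ^ m * √(2 * n + 1) * (-1) ^ n)
        * ((realShiftedLegendre m).eval x * (realShiftedLegendre n).eval x) := by
      intro x; rw [shiftedP_eq, shiftedP_eq]; ring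
    simp_rw [e]
    rw [intervalIntegral.integral_const_mul, h, mul_zero]
  split_ifs with hmn
  · subst hmn
    have e : ∀ x, shiftedP m x * shiftedP m x = (2 * m + 1)
        * ((realShiftedLegendre m).eval x * (realShiftedLegendre m).eval x) := by
      intro x; rw [shiftedP_eq]
      have h3 : ((-1 : ℝ) ^ m) * (-1) ^ m = 1 := by rw [← mul_pow]; norm_num
      have h4 : √(2 * (m : ℝ) + 1) * √(2 * m + 1) = 2 * m + 1 :=
        Real.mul_self_sqrt (by positivity)
      calc _ = (√(2 * (m : ℝ) + 1) * √(2 * m + 1)) * (((-1 : ℝ) ^ m) * (-1) ^ m) *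
            ((realShiftedLegendre m).eval x * (realShiftedLegendre m).eval x) := by ring
        _ = _ := by rw [h3, h4]; ring
    simp_rw [e]
    rw [intervalIntegral.integral_const_mul, integral_realShiftedLegendre_sq]
    have : (2 * (m : ℝ) + 1) ≠ 0 := by positivity
    field_simp
  · rcases lt_or_gt_of_ne hmn with h | h
    · simpa only [mul_comm] using hlt n m h
    · exact hlt m n h

end Legendre

/-! ### Completeness in `L²(E)` and Parseval's identity -/

section LegendreBasis

open Polynomial

theorem integral_restrict_E (u : ℝ → ℝ) :
    ∫ x, u x ∂(volume.restrict E) = ∫ x in (0 : ℝ)..1, u x := by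
  rw [intervalIntegral.integral_of_le zero_le_one, integral_Ioc_eq_integral_Ioo, E]

instance : IsFiniteMeasure (volume.restrict E) := by
  rw [E]; infer_instance

theorem memLp_of_continuous {u : ℝ → ℝ} (hu : Continuous u) (p : ENNReal) :
    MemLp u p (volume.restrict E) := by
  obtain ⟨C, hC⟩ := (isCompact_Icc (a := (0 : ℝ)) (b := 1)).exists_bound_of_continuousOn
    hu.continuousOn
  refine MemLp.of_bound hu.aestronglyMeasurable C ?_
  rw [E]
  filter_upwards [ae_restrict_mem measurableSet_Ioo] with x hx
  exact hC x (Ioo_subset_Icc_self hx)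

/-- The normalized shifted Legendre polynomials as elements of `L²(E)`. -/
def shiftedPLp (n : ℕ) : Lp ℝ 2 (volume.restrict E) :=
  (memLp_of_continuous (continuous_shiftedP n) 2).toLp

theorem inner_shiftedPLp {f : ℝ → ℝ} (hf : MemLp f 2 (volume.restrict E)) (n : ℕ) :
    inner ℝ (shiftedPLp n) hf.toLp = legendreCoeff f n := by
  rw [L2.inner_def, legendreCoeff, ← integral_restrict_E]
  refine integral_congr_ae ?_
  filter_upwards [(memLp_of_continuous (continuous_shiftedP n) 2).coeFn_toLp, hf.coeFn_toLp]
    with x h1 h2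
  simp [shiftedPLp, h1, h2]

theorem orthonormal_shiftedPLp : Orthonormal ℝ shiftedPLp := by
  rw [orthonormal_iff_ite]
  intro m n
  rw [show shiftedPLp n = (memLp_of_continuous (continuous_shiftedP n) 2).toLp from rfl,
    inner_shiftedPLp, legendreCoeff]
  simpa [eq_comm] using integral_shiftedP_mul_shiftedP n m

/-- Induction on the degree: the `n`-th Legendre polynomial has degree exactly `n`, so subtracting a
multiple of it removes the top coefficient. -/
theorem integral_mul_eval_eq_zero {u : ℝ → ℝ} (hu : Integrable u (volume.restrict E))
    (h : ∀ n, legendreCoeff u n = 0) (p : ℝ[X]) :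
    ∫ x, u x * p.eval x ∂(volume.restrict E) = 0 := by
  have hint : ∀ q : ℝ[X], Integrable (fun x => u x * q.eval x) (volume.restrict E) := by
    intro q
    obtain ⟨C, hC⟩ := (isCompact_Icc (a := (0 : ℝ)) (b := 1)).exists_bound_of_continuousOn
      q.continuous.continuousOn
    refine hu.mul_bdd (c := C) q.continuous.aestronglyMeasurable ?_
    rw [E]
    filter_upwards [ae_restrict_mem measurableSet_Ioo] with x hx
    exact hC x (Ioo_subset_Icc_self hx)
  have key : ∀ n : ℕ, ∀ q : ℝ[X], q.degree < n →
      ∫ x, u x * q.eval x ∂(volume.restrict E) = 0 := by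
    intro n
    induction n with
    | zero =>
      intro q hq
      have : q = 0 := by simpa using hq
      simp [this]
    | succ n ih =>
      intro q hq
      set P := realShiftedLegendre n
      have hP : P.coeff n ≠ 0 := by
        rw [coeff_realShiftedLegendre]
        have := (Nat.choose_pos (show n ≤ n + n by simp)).ne'
        simp [this]
      have hSL : ∫ x, u x * P.eval x ∂(volume.restrict E) = 0 := by
        have h1 := h n
        rw [legendreCoeff, ← integral_restrict_E] at h1
        have e : ∀ x, u x * shiftedP n x
            = (√(2 * n + 1) * (-1) ^ n) * (u x * P.eval x) := by
          intro x; rw [shiftedP_eq]; ring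
        simp_rw [e] at h1
        rw [integral_const_mul] at h1
        have h2 : √(2 * (n : ℝ) + 1) ≠ 0 := by positivity
        simpa [h2] using h1
      set c := q.coeff n / P.coeff n
      have hlt : (q - C c * P).degree < n := by
        rw [degree_lt_iff_coeff_zero]
        intro j hj
        rcases eq_or_lt_of_le hj with rfl | hj
        · simp [c, hP]
        · have h1 : q.coeff j = 0 := coeff_eq_zero_of_degree_lt
            (lt_of_lt_of_le hq (by exact_mod_cast hj))
          have h2 : P.coeff j = 0 := coeff_eq_zero_of_natDegree_lt
            (by rw [natDegree_realShiftedLegendre]; exact hj)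
          simp [h1, h2]
      have e : ∀ x, u x * q.eval x = u x * (q - C c * P).eval x + c * (u x * P.eval x) := by
        intro x; simp; ring
      simp_rw [e]
      rw [integral_add (hint _) ((hint _).const_mul _), integral_const_mul, hSL, ih _ hlt]
      simp
  exact key (p.natDegree + 1) p (degree_lt_iff_coeff_zero _ _ |>.mpr fun j hj =>
    coeff_eq_zero_of_natDegree_lt (by omega))

/-- Weierstrass approximation extends the orthogonality from polynomials to continuous functions. -/
theorem integral_mul_continuous_eq_zero {u : ℝ → ℝ} (hu : Integrable u (volume.restrict E))
    (h : ∀ n, legendreCoeff u n = 0) {φ : ℝ → ℝ} (hφ : Continuous φ) :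
    ∫ x, u x * φ x ∂(volume.restrict E) = 0 := by
  have hbdd : ∀ ψ : ℝ → ℝ, Continuous ψ →
      Integrable (fun x => u x * ψ x) (volume.restrict E) := by
    intro ψ hψ
    obtain ⟨C, hC⟩ := (isCompact_Icc (a := (0 : ℝ)) (b := 1)).exists_bound_of_continuousOn
      hψ.continuousOn
    refine hu.mul_bdd (c := C) hψ.aestronglyMeasurable ?_
    rw [E]
    filter_upwards [ae_restrict_mem measurableSet_Ioo] with x hx
    exact hC x (Ioo_subset_Icc_self hx)
  set I := ∫ x, ‖u x‖ ∂(volume.restrict E)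
  have hI : 0 ≤ I := integral_nonneg fun _ => norm_nonneg _
  have key : ∀ ε > 0, ‖∫ x, u x * φ x ∂(volume.restrict E)‖ ≤ ε * I := by
    intro ε hε
    obtain ⟨p, hp⟩ := exists_polynomial_near_of_continuousOn 0 1 φ hφ.continuousOn ε hε
    have e : ∫ x, u x * φ x ∂(volume.restrict E)
        = ∫ x, u x * (φ x - p.eval x) ∂(volume.restrict E) := by
      simp_rw [mul_sub]
      rw [integral_sub (hbdd _ hφ) (hbdd _ p.continuous), integral_mul_eval_eq_zero hu h, sub_zero]
    rw [e, ← integral_const_mul]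
    refine norm_integral_le_of_norm_le (hu.norm.const_mul ε) ?_
    rw [E]
    filter_upwards [ae_restrict_mem measurableSet_Ioo] with x hx
    rw [norm_mul, mul_comm]
    gcongr
    rw [norm_sub_rev]
    exact (hp x (Ioo_subset_Icc_self hx)).le
  by_contra hne
  have hpos : 0 < ‖∫ x, u x * φ x ∂(volume.restrict E)‖ := norm_pos_iff.mpr hne
  have := key (‖∫ x, u x * φ x ∂(volume.restrict E)‖ / (2 * (I + 1))) (by positivity)
  rw [div_mul_eq_mul_div, le_div_iff₀ (by positivity)] at this
  nlinarith

theorem ae_eq_zero_of_legendreCoeff_eq_zero {u : ℝ → ℝ} (hu : Integrable u (volume.restrict E))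
    (h : ∀ n, legendreCoeff u n = 0) : u =ᵐ[volume.restrict E] 0 := by
  have hE : IsOpen E := isOpen_Ioo
  have key := hE.ae_eq_zero_of_integral_contDiff_smul_eq_zero (μ := volume) (f := u)
    (IntegrableOn.locallyIntegrableOn hu) ?_
  · rw [Filter.EventuallyEq, ae_restrict_iff' hE.measurableSet]
    exact key
  · intro φ hφ _ hs
    rw [← setIntegral_eq_integral_of_forall_compl_eq_zero (s := E), ←
      integral_mul_continuous_eq_zero hu h hφ.continuous]
    · simp_rw [smul_eq_mul, mul_comm]
    · intro x hx
      have : φ x = 0 := image_eq_zero_of_notMem_tsupport fun h => hx (hs h)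
      simp [this]

theorem span_shiftedPLp_orthogonal : (Submodule.span ℝ (range shiftedPLp))ᗮ = ⊥ := by
  rw [Submodule.eq_bot_iff]
  intro u hu
  have hu2 : MemLp u 2 (volume.restrict E) := Lp.memLp u
  have h : ∀ n, legendreCoeff u n = 0 := by
    intro n
    rw [← inner_shiftedPLp hu2 n, Lp.toLp_coeFn]
    exact (Submodule.mem_orthogonal _ _).mp hu _ (Submodule.subset_span ⟨n, rfl⟩)
  exact (Lp.eq_zero_iff_ae_eq_zero).mpr
    (ae_eq_zero_of_legendreCoeff_eq_zero (hu2.integrable (by norm_num)) h)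

/-- The Hilbert basis of `L²(E)` formed by the normalized shifted Legendre polynomials. -/
def legendreBasis : HilbertBasis ℕ ℝ (Lp ℝ 2 (volume.restrict E)) :=
  HilbertBasis.mkOfOrthogonalEqBot orthonormal_shiftedPLp span_shiftedPLp_orthogonal

theorem legendreCoeff_sub_partialSum {f : ℝ → ℝ} (hf : MemLp f 2 (volume.restrict E)) (N n : ℕ) :
    legendreCoeff (fun x => f x - legendrePartialSum f N x) n
      = if n ≤ N then 0 else legendreCoeff f n := by
  have hfP : IntervalIntegrable (fun x => f x * shiftedP n x) volume 0 1 := by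
    rw [intervalIntegrable_iff_integrableOn_Ioo_of_le zero_le_one]
    exact hf.integrable_mul (memLp_of_continuous (continuous_shiftedP n) 2)
  have e : ∀ x, (f x - legendrePartialSum f N x) * shiftedP n x = f x * shiftedP n x
      - ∑ m ∈ Finset.range (N + 1), legendreCoeff f m * (shiftedP m x * shiftedP n x) := by
    intro x
    rw [legendrePartialSum, sub_mul, Finset.sum_mul]
    simp_rw [mul_assoc]
  have hPP : ∀ m, IntervalIntegrable (fun x => legendreCoeff f m * (shiftedP m x * shiftedP n x))
      volume 0 1 := fun m => (continuous_const.mul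
        ((continuous_shiftedP m).mul (continuous_shiftedP n))).intervalIntegrable 0 1
  rw [legendreCoeff]
  simp_rw [e]
  rw [intervalIntegral.integral_sub hfP, intervalIntegral.integral_finsetSum]
  · simp_rw [intervalIntegral.integral_const_mul, integral_shiftedP_mul_shiftedP]
    rw [← legendreCoeff]
    split_ifs with h
    · simp [h]
    · simp [h]
  · exact fun m _ => hPP m
  · have := IntervalIntegrable.sum (Finset.range (N + 1)) (fun m _ => hPP m)
    convert! this using 1
    ext x; simp

theorem continuous_legendrePartialSum (f : ℝ → ℝ) (N : ℕ) :
    Continuous (legendrePartialSum f N) :=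
  continuous_finsetSum _ fun n _ => continuous_const.mul (continuous_shiftedP n)

/-- A bound for the squares of the Legendre coefficients of order above `N` bounds the error of
the truncated Legendre expansion. -/
theorem normL2_sub_partialSum_le {f : ℝ → ℝ} (hf : MemLp f 2 (volume.restrict E)) (N : ℕ) {C : ℝ}
    (hC : 0 ≤ C)
    (h : ∀ M, ∑ n ∈ Finset.range M, (if n ≤ N then 0 else legendreCoeff f n ^ 2) ≤ C ^ 2) :
    normL2 (fun x => f x - legendrePartialSum f N x) ≤ C := by
  have hr : MemLp (fun x => f x - legendrePartialSum f N x) 2 (volume.restrict E) :=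
    hf.sub (memLp_of_continuous (continuous_legendrePartialSum f N) 2)
  have hnorm : normL2 (fun x => f x - legendrePartialSum f N x) = ‖hr.toLp‖ := by
    rw [Lp.norm_toLp, normL2]
  rw [hnorm]
  refine (pow_le_pow_iff_left₀ (norm_nonneg _) hC two_ne_zero).mp ?_
  have hcoef : ∀ n, inner ℝ (legendreBasis n) hr.toLp
      = if n ≤ N then 0 else legendreCoeff f n := by
    intro n
    rw [legendreBasis, HilbertBasis.coe_mkOfOrthogonalEqBot, inner_shiftedPLp,
      legendreCoeff_sub_partialSum hf]
  -- Parseval for the remainder `f - f_N`, whose coefficients up to `N` are zero.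
  have hs := legendreBasis.hasSum_inner_mul_inner hr.toLp hr.toLp
  rw [real_inner_self_eq_norm_sq] at hs
  rw [← hs.tsum_eq]
  have e : ∀ n, inner ℝ hr.toLp (legendreBasis n) * inner ℝ (legendreBasis n) hr.toLp
      = if n ≤ N then 0 else legendreCoeff f n ^ 2 := by
    intro n
    rw [real_inner_comm, hcoef]
    split_ifs <;> ring
  simp_rw [e]
  refine Real.tsum_le_of_sum_range_le (fun n => ?_) h
  split_ifs <;> positivity

end LegendreBasis

/-! ### The substitution `x = sin² (t / 2)` -/

section ChangeOfVariable

open Real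

/-- The change of variable `x = sin² (t / 2)`. -/
def sinSq (t : ℝ) : ℝ := sin (t / 2) ^ 2

theorem sinSq_eq (t : ℝ) : sinSq t = 1 / 2 - cos t / 2 := by
  rw [sinSq, sin_sq_eq_half_sub]
  congr 3
  ring

theorem one_sub_sinSq (t : ℝ) : 1 - sinSq t = cos (t / 2) ^ 2 := by
  rw [sinSq, sin_sq]; ring

theorem contDiff_sinSq {n : WithTop ℕ∞} : ContDiff ℝ n sinSq := by
  unfold sinSq
  fun_prop

theorem hasDerivAt_sinSq (t : ℝ) : HasDerivAt sinSq (sin t / 2) t := by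
  have h := ((hasDerivAt_cos t).div_const 2).const_sub (1 / 2)
  rw [show sinSq = fun t => 1 / 2 - cos t / 2 from funext sinSq_eq]
  convert! h using 1
  ring

theorem sinSq_neg (t : ℝ) : sinSq (-t) = sinSq t := by simp [sinSq_eq]

theorem sinSq_two_pi_sub (t : ℝ) : sinSq (2 * π - t) = sinSq t := by
  simp [sinSq_eq, cos_two_pi_sub]

@[simp] theorem sinSq_zero : sinSq 0 = 0 := by simp [sinSq]

@[simp] theorem sinSq_pi : sinSq π = 1 := by simp [sinSq]

/-- The weight of `μ` is the reciprocal of the Jacobian of the substitution; this is why `μ` pulls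
back to `dt`. -/
theorem sqrt_sinSq_mul (t : ℝ) : √(sinSq t * (1 - sinSq t)) = |sin t / 2| := by
  rw [one_sub_sinSq, sinSq, ← mul_pow, sqrt_sq_eq_abs]
  congr 1
  have := sin_two_mul (t / 2)
  rw [show 2 * (t / 2) = t by ring] at this
  rw [this]; ring

theorem injOn_sinSq : InjOn sinSq (Icc 0 π) := by
  intro s hs t ht h
  rw [sinSq_eq, sinSq_eq] at h
  exact injOn_cos hs ht (by linarith)

theorem strictMonoOn_sinSq : StrictMonoOn sinSq (Icc 0 π) := by
  intro s hs t ht h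
  rw [sinSq_eq, sinSq_eq]
  have := strictAntiOn_cos hs ht h
  linarith

theorem sinSq_mem_Icc (t : ℝ) : sinSq t ∈ Icc (0 : ℝ) 1 :=
  ⟨sq_nonneg _, sin_sq_le_one _⟩

theorem image_sinSq {s : ℝ} (hs : s ∈ Icc 0 π) : sinSq '' Ioo 0 s = Ioo 0 (sinSq s) := by
  ext x
  constructor
  · rintro ⟨t, ht, rfl⟩
    constructor
    · have := strictMonoOn_sinSq ⟨le_rfl, pi_pos.le⟩ ⟨ht.1.le, ht.2.le.trans hs.2⟩ ht.1
      rwa [sinSq_zero] at this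
    · exact strictMonoOn_sinSq ⟨ht.1.le, ht.2.le.trans hs.2⟩ hs ht.2
  · intro hx
    have := intermediate_value_Ioo hs.1 (contDiff_sinSq (n := 0)).continuous.continuousOn
    rw [sinSq_zero] at this
    exact this hx

theorem image_sinSq_pi : sinSq '' Ioo 0 π = E := by
  rw [image_sinSq ⟨pi_pos.le, le_rfl⟩, sinSq_pi, E]

theorem measurable_sinSq : Measurable sinSq := (contDiff_sinSq (n := 0)).continuous.measurable

theorem sin_pos_of_mem {t : ℝ} (ht : t ∈ Ioo 0 π) : 0 < sin t := sin_pos_of_pos_of_lt_pi ht.1 ht.2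

/-- The change of variable `x = sin² (t / 2)` turns Lebesgue measure on `(0, π)` into `μ`. -/
theorem measurePreserving_sinSq : MeasurePreserving sinSq (volume.restrict (Ioo 0 π)) mu := by
  refine ⟨measurable_sinSq, Measure.ext fun A hA => ?_⟩
  rw [Measure.map_apply measurable_sinSq hA, mu, withDensity_apply _ hA,
    ← lintegral_indicator hA, ← image_sinSq_pi,
    lintegral_image_eq_lintegral_abs_deriv_mul measurableSet_Ioo
      (fun t _ => (hasDerivAt_sinSq t).hasDerivWithinAt)
      (injOn_sinSq.mono Ioo_subset_Icc_self),
    ← lintegral_indicator_one (measurable_sinSq hA)]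
  refine setLIntegral_congr_fun measurableSet_Ioo fun t ht => ?_
  have hp : 0 < sin t / 2 := half_pos (sin_pos_of_mem ht)
  by_cases h : sinSq t ∈ A
  · rw [indicator_of_mem (show t ∈ sinSq ⁻¹' A from h), indicator_of_mem h, sqrt_sinSq_mul,
      ← ENNReal.ofReal_mul (abs_nonneg _), mul_one_div_cancel (abs_pos.mpr hp.ne').ne']
    simp
  · rw [indicator_of_notMem (show t ∉ sinSq ⁻¹' A from h), indicator_of_notMem h, mul_zero]

theorem mu_absolutelyContinuous : mu ≪ volume.restrict E := withDensity_absolutelyContinuous _ _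

instance : IsFiniteMeasure mu := by
  rw [← measurePreserving_sinSq.map_eq]
  infer_instance

theorem one_le_weight {x : ℝ} (hx : x ∈ E) : 1 ≤ 1 / √(x * (1 - x)) := by
  have h1 : 0 < x * (1 - x) := mul_pos hx.1 (by linarith [hx.2])
  rw [le_div_iff₀ (sqrt_pos.mpr h1), one_mul, sqrt_le_iff]
  refine ⟨zero_le_one, ?_⟩
  nlinarith [sq_nonneg (x - 1 / 2)]

/-- The weight is at least `1` on `E`. Hence functions in `L²_μ(E)` are Lebesgue integrable on `E`.
-/
theorem restrict_E_le_mu : volume.restrict E ≤ mu := by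
  refine Measure.le_iff.mpr fun A hA => ?_
  rw [mu, withDensity_apply _ hA, ← setLIntegral_one, E, Measure.restrict_restrict hA]
  refine setLIntegral_mono' (hA.inter measurableSet_Ioo) fun x hx => ?_
  exact ENNReal.one_le_ofReal.mpr (one_le_weight hx.2)

/-- Cauchy–Schwarz on an interval of length `π`. -/
theorem integral_norm_comp_sinSq_le {w : ℝ → ℝ} (hw : MemLp w 2 mu) :
    ∫ t in Ioo 0 π, |w (sinSq t)| ≤ √π * normL2mu w := by
  have hc : MemLp (fun t => w (sinSq t)) 2 (volume.restrict (Ioo 0 π)) :=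
    hw.comp_measurePreserving measurePreserving_sinSq
  have h1 := eLpNorm_le_eLpNorm_mul_rpow_measure_univ (p := 1) (q := 2) (by norm_num)
    hc.aestronglyMeasurable
  have h2 : eLpNorm (fun t => w (sinSq t)) 2 (volume.restrict (Ioo 0 π)) = eLpNorm w 2 mu :=
    eLpNorm_comp_measurePreserving hw.aestronglyMeasurable measurePreserving_sinSq
  have h3 : ∫ t in Ioo 0 π, |w (sinSq t)|
      = (eLpNorm (fun t => w (sinSq t)) 1 (volume.restrict (Ioo 0 π))).toReal := by
    rw [eLpNorm_one_eq_lintegral_enorm, ← integral_norm_eq_lintegral_enorm hc.aestronglyMeasurable]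
    rfl
  rw [h2] at h1
  rw [h3, normL2mu, mul_comm, sqrt_eq_rpow]
  have h4 : (volume.restrict (Ioo 0 π) univ) ^ (1 / (1 : ENNReal).toReal - 1 / (2 : ENNReal).toReal)
      = ENNReal.ofReal (π ^ (1 / 2 : ℝ)) := by
    rw [← ENNReal.ofReal_rpow_of_pos pi_pos]
    norm_num
  rw [h4] at h1
  refine (ENNReal.toReal_mono (ENNReal.mul_ne_top hw.eLpNorm_ne_top ENNReal.ofReal_ne_top)
    h1).trans_eq ?_
  rw [ENNReal.toReal_mul, ENNReal.toReal_ofReal (by positivity)]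

theorem integrable_comp_sinSq {w : ℝ → ℝ} (hw : MemLp w 2 mu) :
    IntegrableOn (fun t => w (sinSq t)) (Ioo 0 π) :=
  measurePreserving_sinSq.integrable_comp_of_integrable (hw.integrable (by norm_num))

/-- Change of variable in a primitive. -/
theorem integral_comp_sinSq_mul_sin (w : ℝ → ℝ) {s : ℝ} (hs : s ∈ Icc 0 π) :
    ∫ t in (0 : ℝ)..s, w (sinSq t) * (sin t / 2) = ∫ x in (0 : ℝ)..sinSq s, w x := by
  rw [intervalIntegral.integral_of_le hs.1, intervalIntegral.integral_of_le (sinSq_mem_Icc s).1,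
    integral_Ioc_eq_integral_Ioo, integral_Ioc_eq_integral_Ioo, ← image_sinSq hs,
    integral_image_eq_integral_abs_deriv_smul measurableSet_Ioo
      (fun t _ => (hasDerivAt_sinSq t).hasDerivWithinAt)
      (injOn_sinSq.mono (Ioo_subset_Icc_self.trans (Icc_subset_Icc_right hs.2)))]
  refine setIntegral_congr_fun measurableSet_Ioo fun t ht => ?_
  have hp : 0 < sin t / 2 := half_pos (sin_pos_of_mem ⟨ht.1, ht.2.trans_le hs.2⟩)
  simp only [abs_of_pos hp, smul_eq_mul]
  ring

/-- The change of variable `x = sin² (t / 2)` pulls null sets of `E` back to null sets. -/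
theorem ae_comp_sinSq {p : ℝ → Prop} (h : ∀ᵐ x ∂(volume.restrict E), p x) :
    ∀ᵐ t ∂(volume.restrict (Ioo (-π) π \ {0})), p (sinSq t) := by
  have h1 : ∀ᵐ t ∂(volume.restrict (Ioo 0 π)), p (sinSq t) :=
    measurePreserving_sinSq.quasiMeasurePreserving.ae (mu_absolutelyContinuous.ae_le h)
  rw [ae_restrict_iff' measurableSet_Ioo] at h1
  rw [ae_restrict_iff' (measurableSet_Ioo.diff (measurableSet_singleton 0))]
  -- `sinSq` is even, so the negative half is the reflection of the positive one.
  have h2 : ∀ᵐ t : ℝ, -t ∈ Ioo 0 π → p (sinSq (-t)) :=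
    (Measure.measurePreserving_neg (volume : Measure ℝ)).quasiMeasurePreserving.ae h1
  filter_upwards [h1, h2] with t ht1 ht2 ht
  rcases lt_or_gt_of_ne (show t ≠ 0 from ht.2) with h0 | h0
  · rw [← sinSq_neg]
    exact ht2 ⟨by linarith, by linarith [ht.1.1]⟩
  · exact ht1 ⟨h0, ht.1.2⟩

end ChangeOfVariable

/-! ### Calculus of primitives of integrable functions -/

section Primitive

/-- On `[0, b]` the function `u` is a primitive of the integrable function `w`. -/
structure IsPrimitive (b : ℝ) (u w : ℝ → ℝ) : Prop where
  intervalIntegrable : IntervalIntegrable w volume 0 b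
  eq_add_integral : ∀ x ∈ Icc 0 b, u x = u 0 + ∫ y in (0 : ℝ)..x, w y

variable {b : ℝ} {u u₁ u₂ w w₁ w₂ : ℝ → ℝ}

theorem IsPrimitive.mono (h : IsPrimitive b u w) {c : ℝ} (hc : c ∈ Icc 0 b) :
    IsPrimitive c u w :=
  ⟨h.intervalIntegrable.mono_set (by
    rw [uIcc_of_le hc.1, uIcc_of_le (hc.1.trans hc.2)]; exact Icc_subset_Icc_right hc.2),
    fun x hx => h.eq_add_integral x ⟨hx.1, hx.2.trans hc.2⟩⟩

theorem IsPrimitive.continuousOn (hb : 0 ≤ b) (h : IsPrimitive b u w) :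
    ContinuousOn u (Icc 0 b) := by
  have := (h.intervalIntegrable.absolutelyContinuousOnInterval_intervalIntegral
    (c := 0) left_mem_uIcc).continuousOn
  rw [uIcc_of_le hb] at this
  exact (continuousOn_const.add this).congr h.eq_add_integral

theorem isPrimitive_of_hasDerivAt {b : ℝ} (h : ∀ x, HasDerivAt u (w x) x) (hw : Continuous w) :
    IsPrimitive b u w := by
  refine ⟨hw.intervalIntegrable _ _, fun x _ => ?_⟩
  rw [intervalIntegral.integral_eq_sub_of_hasDerivAt (fun y _ => h y) (hw.intervalIntegrable _ _)]
  ring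

theorem IsPrimitive.add (h₁ : IsPrimitive b u₁ w₁) (h₂ : IsPrimitive b u₂ w₂) :
    IsPrimitive b (fun x => u₁ x + u₂ x) (fun x => w₁ x + w₂ x) := by
  refine ⟨h₁.intervalIntegrable.add h₂.intervalIntegrable, fun x hx => ?_⟩
  rw [intervalIntegral.integral_add (h₁.mono hx).intervalIntegrable
    (h₂.mono hx).intervalIntegrable, h₁.eq_add_integral x hx, h₂.eq_add_integral x hx]
  ring

theorem isPrimitive_const (c : ℝ) : IsPrimitive b (fun _ => c) (fun _ => 0) :=
  isPrimitive_of_hasDerivAt (fun x => hasDerivAt_const x c) continuous_const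

theorem isPrimitive_sum {ι : Type*} (s : Finset ι) {U W : ι → ℝ → ℝ}
    (h : ∀ i ∈ s, IsPrimitive b (U i) (W i)) :
    IsPrimitive b (fun x => ∑ i ∈ s, U i x) (fun x => ∑ i ∈ s, W i x) := by
  classical
  induction s using Finset.induction_on with
  | empty => simpa using isPrimitive_const 0
  | insert i s hi ih =>
    simp_rw [Finset.sum_insert hi]
    exact (h i (Finset.mem_insert_self _ _)).add
      (ih fun j hj => h j (Finset.mem_insert_of_mem hj))

/-- Integration by parts. -/
theorem IsPrimitive.integral_mul_deriv (hb : 0 ≤ b) (h : IsPrimitive b u w) {v v' : ℝ → ℝ}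
    (hv : ∀ x, HasDerivAt v (v' x) x) (hv' : Continuous v') :
    ∫ x in (0 : ℝ)..b, u x * v' x = u b * v b - u 0 * v 0 - ∫ x in (0 : ℝ)..b, w x * v x := by
  have hvd : deriv v = v' := funext fun x => (hv x).deriv
  have hvC : ContDiff ℝ 1 v :=
    contDiff_one_iff_deriv.mpr ⟨fun x => (hv x).differentiableAt, hvd ▸ hv'⟩
  -- `u` is controlled on `[0, b]` only, so the absolutely continuous function `U`, which differs
  -- from it there by the constant `u 0`, takes its place.
  set U : ℝ → ℝ := fun x => ∫ y in (0 : ℝ)..x, w y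
  have hU : AbsolutelyContinuousOnInterval U 0 b :=
    h.intervalIntegrable.absolutelyContinuousOnInterval_intervalIntegral left_mem_uIcc
  have key := hU.integral_mul_deriv_eq_deriv_mul
    (hvC.contDiffOn.absolutelyContinuousOnInterval (a := 0) (b := b))
  rw [hvd] at key
  have e1 : ∫ x in (0 : ℝ)..b, deriv U x * v x = ∫ x in (0 : ℝ)..b, w x * v x := by
    refine intervalIntegral.integral_congr_ae ?_
    filter_upwards [h.intervalIntegrable.ae_hasDerivAt_integral] with x hx hxb
    rw [(hx (uIoc_subset_uIcc hxb) 0 left_mem_uIcc).deriv]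
  have e2 : ∫ x in (0 : ℝ)..b, u x * v' x
      = ∫ x in (0 : ℝ)..b, (u 0 * v' x + U x * v' x) := by
    refine intervalIntegral.integral_congr fun x hx => ?_
    rw [uIcc_of_le hb] at hx
    simp only [h.eq_add_integral x hx, U]
    ring
  have e3 : ∫ x in (0 : ℝ)..b, v' x = v b - v 0 :=
    intervalIntegral.integral_eq_sub_of_hasDerivAt (fun x _ => hv x) (hv'.intervalIntegrable _ _)
  have e4 : IntervalIntegrable (fun x => U x * v' x) volume 0 b :=
    (hU.continuousOn.mul hv'.continuousOn).intervalIntegrable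
  rw [e2, intervalIntegral.integral_add ((hv'.intervalIntegrable _ _).const_mul _) e4, key, e1,
    intervalIntegral.integral_const_mul, e3, h.eq_add_integral b ⟨hb, le_rfl⟩]
  simp only [U, intervalIntegral.integral_same]
  ring

/-- The product rule in integrated form is integration by parts on each `[0, x]`. -/
theorem IsPrimitive.mul (hb : 0 ≤ b) (h : IsPrimitive b u w) {v v' : ℝ → ℝ}
    (hv : ∀ x, HasDerivAt v (v' x) x) (hv' : Continuous v') :
    IsPrimitive b (fun x => v x * u x) (fun x => v' x * u x + v x * w x) := by
  have hvc : Continuous v := continuous_iff_continuousAt.mpr fun x => (hv x).continuousAt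
  have i1 : IntervalIntegrable (fun x => v' x * u x) volume 0 b := by
    refine ContinuousOn.intervalIntegrable ?_
    rw [uIcc_of_le hb]
    exact hv'.continuousOn.mul (h.continuousOn hb)
  have i2 : IntervalIntegrable (fun x => v x * w x) volume 0 b :=
    h.intervalIntegrable.continuousOn_mul hvc.continuousOn
  refine ⟨i1.add i2, fun x hx => ?_⟩
  have hsub : uIcc 0 x ⊆ uIcc 0 b := by
    rw [uIcc_of_le hx.1, uIcc_of_le hb]; exact Icc_subset_Icc_right hx.2
  rw [intervalIntegral.integral_add (i1.mono_set hsub) (i2.mono_set hsub)]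
  have key := (h.mono hx).integral_mul_deriv hx.1 hv hv'
  simp only [mul_comm (u _) (v' _), mul_comm (w _) (v _)] at key
  rw [key]
  ring

end Primitive

/-! ### From weak derivatives to a smooth representative -/

section DuBoisReymond

theorem isOpen_E : IsOpen E := isOpen_Ioo

theorem exists_Icc_of_isCompact {K : Set ℝ} (hK : IsCompact K) (hKE : K ⊆ E) :
    ∃ a b : ℝ, 0 < a ∧ b < 1 ∧ K ⊆ Icc a b := by
  rcases K.eq_empty_or_nonempty with rfl | hne
  · exact ⟨1 / 2, 1 / 2, by norm_num, by norm_num, empty_subset _⟩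
  · obtain ⟨a, ha⟩ := hK.exists_isLeast hne
    obtain ⟨b, hb⟩ := hK.exists_isGreatest hne
    exact ⟨a, b, (hKE ha.1).1, (hKE hb.1).2, fun x hx => ⟨ha.2 hx, hb.2 hx⟩⟩

/-- A test function on `E` with vanishing integral is the derivative of a test function. -/
theorem exists_test_primitive {θ : ℝ → ℝ} (hθ : ContDiff ℝ ∞ θ) (hc : HasCompactSupport θ)
    (hs : tsupport θ ⊆ E) (h0 : ∫ x in (0 : ℝ)..1, θ x = 0) :
    ∃ ψ : ℝ → ℝ, ContDiff ℝ ∞ ψ ∧ HasCompactSupport ψ ∧ tsupport ψ ⊆ E ∧ deriv ψ = θ := by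
  obtain ⟨a, b, ha, hb, hab⟩ := exists_Icc_of_isCompact hc hs
  have hzero : ∀ x, x ∉ Icc a b → θ x = 0 := fun x hx =>
    image_eq_zero_of_notMem_tsupport fun h => hx (hab h)
  have hd : ∀ x, HasDerivAt (fun x => ∫ y in (0 : ℝ)..x, θ y) (θ x) x := fun x =>
    intervalIntegral.integral_hasDerivAt_right (hθ.continuous.intervalIntegrable _ _)
      (hθ.continuous.stronglyMeasurableAtFilter _ _) hθ.continuous.continuousAt
  have hderiv : deriv (fun x => ∫ y in (0 : ℝ)..x, θ y) = θ := funext fun x => (hd x).deriv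
  have hsupp : Function.support (fun x => ∫ y in (0 : ℝ)..x, θ y) ⊆ Icc a b := by
    intro x hx
    by_contra hxab
    refine hx ?_
    rw [mem_Icc, not_and_or, not_le, not_le] at hxab
    rcases hxab with h | h
    · refine intervalIntegral.integral_zero_ae (Eventually.of_forall fun y hy => ?_) |>.trans rfl
      refine hzero y fun hy' => ?_
      have := hy.2
      rcases le_max_iff.mp this with h' | h' <;> linarith [hy'.1]
    · simp only
      rw [← intervalIntegral.integral_add_adjacent_intervals
        (hθ.continuous.intervalIntegrable 0 1) (hθ.continuous.intervalIntegrable 1 x), h0, zero_add]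
      refine intervalIntegral.integral_zero_ae (Eventually.of_forall fun y hy => ?_)
      refine hzero y fun hy' => ?_
      have := hy.1
      rcases min_lt_iff.mp this with h' | h' <;> linarith [hy'.2]
  have htsupp : tsupport (fun x => ∫ y in (0 : ℝ)..x, θ y) ⊆ Icc a b :=
    closure_minimal hsupp isClosed_Icc
  refine ⟨_, contDiff_infty_iff_deriv.mpr ⟨fun x => (hd x).differentiableAt, by rwa [hderiv]⟩,
    isCompact_Icc.of_isClosed_subset (isClosed_tsupport _) htsupp,
    htsupp.trans fun x hx => ⟨ha.trans_le hx.1, hx.2.trans_lt hb⟩, hderiv⟩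

theorem integrable_mul_test {u φ : ℝ → ℝ} (hu : IntegrableOn u E) (hφ : Continuous φ) :
    IntegrableOn (fun x => u x * φ x) E := by
  obtain ⟨C, hC⟩ := (isCompact_Icc (a := (0 : ℝ)) (b := 1)).exists_bound_of_continuousOn
    hφ.continuousOn
  refine Integrable.mul_bdd (c := C) hu hφ.aestronglyMeasurable ?_
  rw [E]
  filter_upwards [ae_restrict_mem measurableSet_Ioo] with x hx
  exact hC x (Ioo_subset_Icc_self hx)

theorem ae_eq_zero_of_integral_test_eq_zero {u : ℝ → ℝ} (hu : IntegrableOn u E)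
    (h : ∀ φ : ℝ → ℝ, ContDiff ℝ ∞ φ → HasCompactSupport φ → tsupport φ ⊆ E →
      ∫ x in E, u x * φ x = 0) : u =ᵐ[volume.restrict E] 0 := by
  have key := isOpen_E.ae_eq_zero_of_integral_contDiff_smul_eq_zero (μ := volume) (f := u)
    (IntegrableOn.locallyIntegrableOn hu) ?_
  · rw [Filter.EventuallyEq, ae_restrict_iff' isOpen_E.measurableSet]
    exact key
  · intro φ hφ hc hs
    rw [← setIntegral_eq_integral_of_forall_compl_eq_zero (s := E), ← h φ hφ hc hs]
    · simp_rw [smul_eq_mul, mul_comm]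
    · intro x hx
      have : φ x = 0 := image_eq_zero_of_notMem_tsupport fun h => hx (hs h)
      simp [this]

/-- The lemma of du Bois-Reymond. -/
theorem ae_const_of_integral_mul_deriv_eq_zero {u : ℝ → ℝ} (hu : IntegrableOn u E)
    (h : ∀ φ : ℝ → ℝ, ContDiff ℝ ∞ φ → HasCompactSupport φ → tsupport φ ⊆ E →
      ∫ x in E, u x * deriv φ x = 0) : ∃ c : ℝ, u =ᵐ[volume.restrict E] fun _ => c := by
  -- A fixed bump `η` of mass one supported in `E`: for a test function `φ`, the difference `φ - (∫
  -- φ) η` has integral zero and so is the derivative of a test function.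
  let β : ContDiffBump (1 / 2 : ℝ) := ⟨1 / 8, 1 / 4, by norm_num, by norm_num⟩
  set η : ℝ → ℝ := β.normed volume
  have hη : ContDiff ℝ ∞ η := β.contDiff_normed
  have hηc : HasCompactSupport η := β.hasCompactSupport_normed
  have hηs : tsupport η ⊆ E := by
    rw [β.tsupport_normed_eq, Real.closedBall_eq_Icc]
    intro x hx
    simp only [β] at hx
    exact ⟨by linarith [hx.1], by linarith [hx.2]⟩
  have hη1 : ∫ x in E, η x = 1 := by
    rw [setIntegral_eq_integral_of_forall_compl_eq_zero, β.integral_normed]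
    exact fun x hx => image_eq_zero_of_notMem_tsupport fun h => hx (hηs h)
  refine ⟨∫ x in E, u x * η x, ?_⟩
  set c := ∫ x in E, u x * η x
  have hc0 : IntegrableOn (fun _ : ℝ => c) E := integrable_const c
  have key := ae_eq_zero_of_integral_test_eq_zero (u := fun x => u x - c) (hu.sub hc0) ?_
  · filter_upwards [key] with x hx
    exact sub_eq_zero.mp hx
  · intro φ hφ hφc hφs
    set I := ∫ x in E, φ x
    have hθs : tsupport (fun x => φ x - I * η x) ⊆ E := by
      refine (tsupport_sub φ (fun x => I * η x)).trans (union_subset hφs ?_)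
      exact (tsupport_mul_subset_right (f := fun _ => I) (g := η)).trans hηs
    have hφi : IntegrableOn φ E := by
      simpa using integrable_mul_test (u := fun _ => 1) (integrable_const 1) hφ.continuous
    have hηi : IntegrableOn η E := by
      simpa using integrable_mul_test (u := fun _ => 1) (integrable_const 1) hη.continuous
    obtain ⟨ψ, hψ, hψc, hψs, hψd⟩ := exists_test_primitive (θ := fun x => φ x - I * η x)
      (hφ.sub (contDiff_const.mul hη)) (hφc.sub hηc.mul_left) hθs (by
        rw [← integral_restrict_E, integral_sub hφi (hηi.const_mul I), integral_const_mul, hη1]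
        simp [I])
    have h1 := h ψ hψ hψc hψs
    rw [hψd] at h1
    simp_rw [mul_sub] at h1
    rw [integral_sub (integrable_mul_test hu hφ.continuous)
      (integrable_mul_test hu (hη.continuous.const_mul I))] at h1
    simp_rw [sub_mul]
    rw [integral_sub (integrable_mul_test hu hφ.continuous)
      (integrable_mul_test hc0 hφ.continuous), integral_const_mul]
    rw [← h1]
    congr 1
    simp_rw [mul_left_comm _ I]
    rw [integral_const_mul]
    ring

/-- Testing order `j + 1` against `φ` is testing order `j` against `φ'`. -/
theorem IsWeakDeriv.succ_of_eq {U : Set ℝ} {j : ℕ} {g w w' : ℝ → ℝ} (h : IsWeakDeriv U j g w)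
    (h' : IsWeakDeriv U (j + 1) g w') : IsWeakDeriv U 1 w w' := by
  refine ⟨h.locInt_right, h'.locInt_right, fun φ hφ hc hs => ?_⟩
  have h1 := h.integral_eq (deriv φ) (contDiff_infty_iff_deriv.mp hφ).2 hc.deriv
    (tsupport_deriv_subset.trans hs)
  have h2 := h'.integral_eq φ hφ hc hs
  rw [iteratedDeriv_succ', h1, pow_succ, mul_assoc] at h2
  have h3 : ((-1 : ℝ) ^ j) ≠ 0 := by positivity
  simpa using mul_left_cancel₀ h3 h2

/-- A function with an integrable weak derivative on `E` is a primitive of it. -/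
theorem IsWeakDeriv.exists_eq_primitive {u w : ℝ → ℝ} (hu : IntegrableOn u E)
    (hw : IntegrableOn w E) (h : IsWeakDeriv E 1 u w) :
    ∃ c : ℝ, u =ᵐ[volume.restrict E] fun x => c + ∫ y in (0 : ℝ)..x, w y := by
  have hwi : IntervalIntegrable w volume 0 1 := by
    rwa [intervalIntegrable_iff_integrableOn_Ioo_of_le zero_le_one]
  set v : ℝ → ℝ := fun x => ∫ y in (0 : ℝ)..x, w y
  have hv : IsPrimitive 1 v w := ⟨hwi, fun x _ => by simp [v]⟩
  have hvi : IntegrableOn v E := by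
    refine IntegrableOn.mono_set ?_ (Ioo_subset_Icc_self : E ⊆ _)
    exact (hv.continuousOn zero_le_one).integrableOn_Icc
  obtain ⟨c, hc⟩ := ae_const_of_integral_mul_deriv_eq_zero (u := fun x => u x - v x)
    (hu.sub hvi) (by
      intro φ hφ hφc hφs
      have h1 := h.integral_eq φ hφ hφc hφs
      have hdc : Continuous (deriv φ) := (contDiff_infty_iff_deriv.mp hφ).2.continuous
      have h2 := hv.integral_mul_deriv zero_le_one
        (fun x => ((contDiff_infty_iff_deriv.mp hφ).1 x).hasDerivAt) hdc
      have h0 : φ 0 = 0 := image_eq_zero_of_notMem_tsupport fun h => absurd (hφs h).1 (lt_irrefl _)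
      have h1' : φ 1 = 0 := image_eq_zero_of_notMem_tsupport fun h => absurd (hφs h).2 (lt_irrefl _)
      simp only [iteratedDeriv_one] at h1
      simp_rw [sub_mul]
      rw [integral_sub (integrable_mul_test hu hdc) (integrable_mul_test hvi hdc), h1,
        integral_restrict_E, integral_restrict_E, h2, h0, h1']
      ring)
  refine ⟨c, ?_⟩
  filter_upwards [hc] with x hx
  linarith

/-- A function on `E` with integrable weak derivatives has a smooth representative. -/
theorem exists_contDiff_representative (m : ℕ) (w : ℕ → ℝ → ℝ)
    (hint : ∀ j ≤ m, IntegrableOn (w j) E) (hw : ∀ j < m, IsWeakDeriv E 1 (w j) (w (j + 1)))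
    {F : ℝ → ℝ} (hF : Continuous F) (hwF : w m =ᵐ[volume.restrict E] F) :
    ∃ γ : ℝ → ℝ, ContDiff ℝ m γ ∧ (∀ j ≤ m, w j =ᵐ[volume.restrict E] iteratedDeriv j γ) ∧
      iteratedDeriv m γ = F := by
  induction m generalizing w with
  | zero =>
    refine ⟨F, by simpa using hF, fun j hj => ?_, iteratedDeriv_zero⟩
    obtain rfl : j = 0 := by omega
    simpa using hwF
  | succ m ih =>
    -- The induction removes the function at the bottom: the shifted family has a representative,
    -- and one integration recovers `w 0`.
    obtain ⟨γ, hγ, hγj, hγm⟩ := ih (fun j => w (j + 1)) (fun j hj => hint _ (by omega))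
      (fun j hj => hw _ (by omega)) hwF
    obtain ⟨c, hc⟩ := (hw 0 (by omega)).exists_eq_primitive (hint 0 (by omega)) (hint 1 (by omega))
    have hd : ∀ x, HasDerivAt (fun x => c + ∫ y in (0 : ℝ)..x, γ y) (γ x) x := fun x =>
      (intervalIntegral.integral_hasDerivAt_right (hγ.continuous.intervalIntegrable _ _)
        (hγ.continuous.stronglyMeasurableAtFilter _ _) hγ.continuous.continuousAt).const_add c
    have hderiv : deriv (fun x => c + ∫ y in (0 : ℝ)..x, γ y) = γ := funext fun x => (hd x).deriv
    refine ⟨fun x => c + ∫ y in (0 : ℝ)..x, γ y, ?_, fun j hj => ?_, ?_⟩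
    · push_cast
      rw [contDiff_succ_iff_deriv, hderiv]
      exact ⟨fun x => (hd x).differentiableAt, fun h => by simp at h, hγ⟩
    · rcases j with _ | j
      · have h1 := hγj 0 (by omega)
        rw [iteratedDeriv_zero, EventuallyEq, ae_restrict_iff' isOpen_E.measurableSet] at h1
        filter_upwards [hc, ae_restrict_mem isOpen_E.measurableSet] with x hx hxE
        rw [hx, iteratedDeriv_zero]
        congr 1
        refine intervalIntegral.integral_congr_ae ?_
        filter_upwards [h1] with y hy hyx
        rw [uIoc_of_le hxE.1.le] at hyx
        exact hy ⟨hyx.1, hyx.2.trans_lt hxE.2⟩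
      · rw [iteratedDeriv_succ', hderiv]
        exact hγj j (by omega)
    · rw [iteratedDeriv_succ', hderiv, hγm]

end DuBoisReymond

/-! ### Derivatives of `γ (sin² (t / 2))` and bounds for their coefficients -/

section ChainRule

open Real

/-- The coefficients in the formula of Faà di Bruno for `γ (sin² (t / 2))`: the derivative of
order `i` is `∑ j, chainCoeff i j t * γ⁽ʲ⁾ (sin² (t / 2))`. -/
def chainCoeff : ℕ → ℕ → ℝ → ℝ
  | 0, 0 => fun _ => 1
  | 0, _ + 1 => fun _ => 0
  | i + 1, 0 => deriv (chainCoeff i 0)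
  | i + 1, j + 1 => fun t => deriv (chainCoeff i (j + 1)) t + chainCoeff i j t * (sin t / 2)

theorem contDiff_chainCoeff (i j : ℕ) : ContDiff ℝ ∞ (chainCoeff i j) := by
  induction i generalizing j with
  | zero => cases j <;> exact contDiff_const
  | succ i ih =>
    cases j with
    | zero => exact (contDiff_infty_iff_deriv.mp (ih 0)).2
    | succ j =>
      exact (contDiff_infty_iff_deriv.mp (ih (j + 1))).2.add
        ((ih j).mul (contDiff_sin.div_const 2))

theorem chainCoeff_eq_zero {i j : ℕ} (h : i < j) : chainCoeff i j = fun _ => 0 := by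
  induction i generalizing j with
  | zero =>
    cases j with
    | zero => omega
    | succ j => rfl
  | succ i ih =>
    cases j with
    | zero => omega
    | succ j =>
      funext t
      simp [chainCoeff, ih (show i < j + 1 by omega), ih (show i < j by omega)]

theorem hasDerivAt_chainCoeff (i j : ℕ) (t : ℝ) :
    HasDerivAt (chainCoeff i j) (deriv (chainCoeff i j) t) t :=
  ((contDiff_infty_iff_deriv.mp (contDiff_chainCoeff i j)).1 t).hasDerivAt

theorem continuous_deriv_chainCoeff (i j : ℕ) : Continuous (deriv (chainCoeff i j)) :=
  (contDiff_infty_iff_deriv.mp (contDiff_chainCoeff i j)).2.continuous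

/-- The product rule regrouped by the order of the derivative of `γ`. With arbitrary numbers `G j`
it also serves the top order, where the derivative is merely an integrable function. -/
theorem sum_chainCoeff_succ (i : ℕ) (t : ℝ) (G : ℕ → ℝ) :
    ∑ j ∈ Finset.range (i + 2), chainCoeff (i + 1) j t * G j
      = ∑ j ∈ Finset.range (i + 1),
        (deriv (chainCoeff i j) t * G j + chainCoeff i j t * (G (j + 1) * (sin t / 2))) := by
  have h0 : deriv (chainCoeff i (i + 1)) t = 0 := by
    rw [chainCoeff_eq_zero (Nat.lt_succ_self i)]; simp
  have h1 : ∑ j ∈ Finset.range (i + 1), deriv (chainCoeff i j) t * G j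
      = ∑ j ∈ Finset.range (i + 2), deriv (chainCoeff i j) t * G j := by
    rw [Finset.sum_range_succ _ (i + 1), h0]; simp
  rw [Finset.sum_add_distrib, h1, Finset.sum_range_succ', Finset.sum_range_succ' _ (i + 1)]
  simp only [chainCoeff]
  rw [add_right_comm, ← Finset.sum_add_distrib]
  congr 1
  refine Finset.sum_congr rfl fun j _ => ?_
  ring

theorem abs_iteratedDeriv_sin_cos_le_one (n : ℕ) (t : ℝ) :
    |iteratedDeriv n sin t| ≤ 1 ∧ |iteratedDeriv n cos t| ≤ 1 := by
  induction n with
  | zero => simpa using ⟨abs_sin_le_one t, abs_cos_le_one t⟩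
  | succ n ih =>
    rw [iteratedDeriv_add_one_sin, iteratedDeriv_add_one_cos]
    simpa using ih.symm

/-- All derivatives of the sine are bounded by `1`, so Leibniz' rule turns the growth rate `d` into
`d + 1` by the binomial theorem. -/
theorem abs_iteratedDeriv_mul_sin_le {a : ℝ → ℝ} (ha : ContDiff ℝ ∞ a) {C d : ℝ}
    (h : ∀ l t, |iteratedDeriv l a t| ≤ C * d ^ l) (l : ℕ) (t : ℝ) :
    |iteratedDeriv l (fun t => a t * (sin t / 2)) t| ≤ C / 2 * (d + 1) ^ l := by
  have e : (fun t => a t * (sin t / 2)) = fun t => (a t * sin t) * (1 / 2) := by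
    funext t; ring
  rw [e, iteratedDeriv_mul_const_field, iteratedDeriv_fun_mul (ha.contDiffAt.of_le (by exact_mod_cast le_top))
    contDiff_sin.contDiffAt, abs_mul, add_pow]
  have : |∑ i ∈ Finset.range (l + 1), (l.choose i : ℝ) * iteratedDeriv i a t
      * iteratedDeriv (l - i) sin t|
      ≤ ∑ i ∈ Finset.range (l + 1), C * (d ^ i * 1 ^ (l - i) * l.choose i) := by
    refine (Finset.abs_sum_le_sum_abs _ _).trans (Finset.sum_le_sum fun i _ => ?_)
    rw [abs_mul, abs_mul, Nat.abs_cast]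
    have h1 := h i t
    have h2 := (abs_iteratedDeriv_sin_cos_le_one (l - i) t).1
    calc (l.choose i : ℝ) * |iteratedDeriv i a t| * |iteratedDeriv (l - i) sin t|
        ≤ (l.choose i : ℝ) * (C * d ^ i) * 1 := by
          have : 0 ≤ C * d ^ i := (abs_nonneg _).trans h1
          gcongr
      _ = _ := by simp; ring
  rw [← Finset.mul_sum] at this
  rw [show |(1 / 2 : ℝ)| = 1 / 2 by norm_num]
  linarith

/-- The coefficient behaves like a trigonometric polynomial of degree `j`: each derivative costs a
factor `j`. All `l` are treated at once because the recursion differentiates. For index `j + 1` the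
differentiated term contributes at most `i * i! (j + 1)^l` (it is zero unless `j + 1 ≤ i`) and the
product term `i!/2 * (j + 1)^l`; together they stay below `(i + 1)! (j + 1)^l`. -/
theorem abs_iteratedDeriv_chainCoeff_le (i j l : ℕ) (t : ℝ) :
    |iteratedDeriv l (chainCoeff i j) t| ≤ i.factorial * (j : ℝ) ^ l := by
  induction i generalizing j l t with
  | zero =>
    cases j with
    | zero =>
      cases l with
      | zero => simp [chainCoeff]
      | succ l => simp [chainCoeff, iteratedDeriv_const]
    | succ j =>
      have : chainCoeff 0 (j + 1) = fun _ => 0 := rfl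
      rw [this, iteratedDeriv_const]
      split_ifs <;> simp <;> positivity
  | succ i ih =>
    cases j with
    | zero =>
      have h := ih 0 (l + 1) t
      rw [iteratedDeriv_succ'] at h
      have h0 : |iteratedDeriv l (chainCoeff (i + 1) 0) t| ≤ 0 := by simpa [chainCoeff] using h
      refine h0.trans (by positivity)
    | succ j =>
      have h1 := ih (j + 1) (l + 1) t
      have h2 := abs_iteratedDeriv_mul_sin_le (contDiff_chainCoeff i j) (fun l t => ih j l t) l t
      have hle : (l : WithTop ℕ∞) ≤ ∞ := by exact_mod_cast le_top
      have e : iteratedDeriv l (chainCoeff (i + 1) (j + 1)) t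
          = iteratedDeriv l (deriv (chainCoeff i (j + 1))) t
            + iteratedDeriv l (fun t => chainCoeff i j t * (sin t / 2)) t := by
        rw [← iteratedDeriv_fun_add]
        · rfl
        · exact (contDiff_infty_iff_deriv.mp (contDiff_chainCoeff i (j + 1))).2.contDiffAt.of_le hle
        · exact ((contDiff_chainCoeff i j).mul (contDiff_sin.div_const 2)).contDiffAt.of_le hle
      rw [e]
      refine (abs_add_le _ _).trans ?_
      rw [Nat.factorial_succ]
      push_cast at h1 ⊢
      have hp : 0 ≤ (i.factorial : ℝ) * ((j : ℝ) + 1) ^ l := by positivity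
      rcases lt_or_ge i (j + 1) with hij | hij
      · have h0 : iteratedDeriv l (deriv (chainCoeff i (j + 1))) t = 0 := by
          rw [← iteratedDeriv_succ', chainCoeff_eq_zero hij, iteratedDeriv_const]; simp
        rw [h0, abs_zero, zero_add]
        refine h2.trans ?_
        nlinarith [mul_nonneg (Nat.cast_nonneg (α := ℝ) i) hp]
      · rw [iteratedDeriv_succ', pow_succ] at h1
        have hij' : (j : ℝ) + 1 ≤ i := by exact_mod_cast hij
        nlinarith [mul_le_mul_of_nonneg_right hij' hp]

theorem abs_chainCoeff_le (i j : ℕ) (t : ℝ) : |chainCoeff i j t| ≤ i.factorial := by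
  simpa using abs_iteratedDeriv_chainCoeff_le i j 0 t

theorem hasDerivAt_iteratedDeriv {γ : ℝ → ℝ} {m j : ℕ} (hγ : ContDiff ℝ m γ) (hj : j < m) (x : ℝ) :
    HasDerivAt (iteratedDeriv j γ) (iteratedDeriv (j + 1) γ x) x := by
  rw [iteratedDeriv_succ]
  exact (hγ.differentiable_iteratedDeriv j (by exact_mod_cast hj) x).hasDerivAt

theorem continuous_iteratedDeriv {γ : ℝ → ℝ} {m j : ℕ} (hγ : ContDiff ℝ m γ) (hj : j ≤ m) :
    Continuous (iteratedDeriv j γ) :=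
  hγ.continuous_iteratedDeriv j (by exact_mod_cast hj)

theorem hasDerivAt_iteratedDeriv_comp_sinSq {γ : ℝ → ℝ} {m j : ℕ} (hγ : ContDiff ℝ m γ)
    (hj : j < m) (t : ℝ) : HasDerivAt (fun t => iteratedDeriv j γ (sinSq t))
      (iteratedDeriv (j + 1) γ (sinSq t) * (sin t / 2)) t :=
  (hasDerivAt_iteratedDeriv hγ hj (sinSq t)).comp t (hasDerivAt_sinSq t)

/-- The formula of Faà di Bruno for `γ (sin² (t / 2))`. -/
theorem iteratedDeriv_comp_sinSq {γ : ℝ → ℝ} {m : ℕ} (hγ : ContDiff ℝ m γ) (i : ℕ) (hi : i ≤ m) :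
    iteratedDeriv i (fun t => γ (sinSq t))
      = fun t => ∑ j ∈ Finset.range (i + 1), chainCoeff i j t * iteratedDeriv j γ (sinSq t) := by
  induction i with
  | zero =>
    funext t
    simp [chainCoeff]
  | succ i ih =>
    rw [iteratedDeriv_succ, ih (by omega)]
    funext t
    rw [sum_chainCoeff_succ i t (fun j => iteratedDeriv j γ (sinSq t))]
    refine HasDerivAt.deriv (HasDerivAt.fun_sum fun j hj => ?_)
    have hj' : j < i + 1 := Finset.mem_range.mp hj
    exact (hasDerivAt_chainCoeff i j t).mul
      (hasDerivAt_iteratedDeriv_comp_sinSq hγ (by omega) t)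

theorem IsPrimitive.comp_sinSq {u w : ℝ → ℝ} (h : IsPrimitive 1 u w) :
    IsPrimitive π (fun t => u (sinSq t)) (fun t => w (sinSq t) * (sin t / 2)) := by
  refine ⟨?_, fun t ht => ?_⟩
  · rw [intervalIntegrable_iff_integrableOn_Ioo_of_le pi_pos.le]
    have h1 : IntegrableOn w (sinSq '' Ioo 0 π) := by
      rw [image_sinSq_pi, E, ← intervalIntegrable_iff_integrableOn_Ioo_of_le zero_le_one]
      exact h.intervalIntegrable
    rw [integrableOn_image_iff_integrableOn_abs_deriv_smul measurableSet_Ioo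
      (fun t _ => (hasDerivAt_sinSq t).hasDerivWithinAt)
      (injOn_sinSq.mono Ioo_subset_Icc_self)] at h1
    refine h1.congr_fun (fun t ht => ?_) measurableSet_Ioo
    have hp : 0 < sin t / 2 := half_pos (sin_pos_of_mem ht)
    simp only [abs_of_pos hp, smul_eq_mul]
    ring
  · rw [integral_comp_sinSq_mul_sin w ht, sinSq_zero, h.eq_add_integral _ (sinSq_mem_Icc t)]

/-- The formula of Faà di Bruno for `γ (sin² (t / 2))`, where the last derivative of `γ` exists
in the sense of absolutely continuous functions only. -/
theorem isPrimitive_iteratedDeriv_comp_sinSq {γ w : ℝ → ℝ} {m : ℕ} (hγ : ContDiff ℝ m γ)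
    (hw : IsPrimitive 1 (iteratedDeriv m γ) w) {G : ℕ → ℝ → ℝ}
    (hG : ∀ j ≤ m, G j = iteratedDeriv j γ) (hGw : G (m + 1) = w) :
    IsPrimitive π (iteratedDeriv m (fun t => γ (sinSq t)))
      (fun t => ∑ j ∈ Finset.range (m + 2), chainCoeff (m + 1) j t * G j (sinSq t)) := by
  rw [iteratedDeriv_comp_sinSq hγ m le_rfl]
  simp_rw [sum_chainCoeff_succ m _ (fun j => G j (sinSq _))]
  refine isPrimitive_sum _ fun j hj => ?_
  have hj' : j ≤ m := Nat.lt_succ_iff.mp (Finset.mem_range.mp hj)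
  have key : IsPrimitive π (fun t => G j (sinSq t))
      (fun t => G (j + 1) (sinSq t) * (sin t / 2)) := by
    rcases eq_or_lt_of_le hj' with rfl | hlt
    · rw [hG j le_rfl, hGw]
      exact hw.comp_sinSq
    · rw [hG j hj', hG (j + 1) hlt]
      refine isPrimitive_of_hasDerivAt
        (fun t => hasDerivAt_iteratedDeriv_comp_sinSq hγ hlt t) ?_
      exact ((continuous_iteratedDeriv hγ hlt).comp
        (contDiff_sinSq (n := 0)).continuous).mul (continuous_sin.div_const 2)
  have := key.mul pi_pos.le (hasDerivAt_chainCoeff m j) (continuous_deriv_chainCoeff m j)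
  rwa [hG j hj'] at this ⊢

/-- Symmetry about `t = π`. This is why no condition on `g` at `x = 1` is needed. -/
theorem iteratedDeriv_comp_sinSq_pi (γ : ℝ → ℝ) {j : ℕ} (hj : Odd j) :
    iteratedDeriv j (fun t => γ (sinSq t)) π = 0 := by
  have h := iteratedDeriv_comp_const_sub j (fun t => γ (sinSq t)) (2 * π)
  simp_rw [sinSq_two_pi_sub] at h
  have h' := congrFun h π
  rw [hj.neg_one_pow, show 2 * π - π = π by ring] at h'
  simp only [smul_eq_mul] at h'
  linarith

end ChainRule

/-! ### Essential limits at `t = 0` as classical boundary values -/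

section BoundaryValue

theorem integral_mul_iteratedDeriv {h φ : ℝ → ℝ} {m : ℕ} (hh : ContDiff ℝ m h)
    (hφ : ContDiff ℝ ∞ φ) (hc : HasCompactSupport φ) (j : ℕ) (hj : j ≤ m) :
    ∫ x, h x * iteratedDeriv j φ x = (-1) ^ j * ∫ x, iteratedDeriv j h x * φ x := by
  induction j generalizing φ with
  | zero => simp
  | succ j ih =>
    have hφ' := (contDiff_infty_iff_deriv.mp hφ).2
    rw [iteratedDeriv_succ', ih hφ' hc.deriv (by omega)]
    have h1 : Continuous (iteratedDeriv j h) := continuous_iteratedDeriv hh (by omega)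
    have h2 : Continuous (iteratedDeriv (j + 1) h) := continuous_iteratedDeriv hh hj
    rw [integral_mul_deriv_eq_deriv_mul_of_integrable
      (fun x _ => hasDerivAt_iteratedDeriv hh (by omega) x)
      (fun x _ => ((contDiff_infty_iff_deriv.mp hφ).1 x).hasDerivAt)
      ((h1.mul hφ'.continuous).integrable_of_hasCompactSupport hc.deriv.mul_left)
      ((h2.mul hφ.continuous).integrable_of_hasCompactSupport hc.mul_left)
      ((h1.mul hφ.continuous).integrable_of_hasCompactSupport hc.mul_left)]
    ring

theorem tsupport_iteratedDeriv_subset (j : ℕ) (φ : ℝ → ℝ) :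
    tsupport (iteratedDeriv j φ) ⊆ tsupport φ := by
  induction j with
  | zero => simp
  | succ j ih =>
    rw [iteratedDeriv_succ]
    exact tsupport_deriv_subset.trans ih

/-- Classical derivatives are weak derivatives. -/
theorem isWeakDeriv_of_contDiff {U : Set ℝ} {u h : ℝ → ℝ} {m : ℕ}
    (hh : ContDiff ℝ m h) (hu : LocallyIntegrableOn u U) (huh : u =ᵐ[volume.restrict U] h) {j : ℕ}
    (hj : j ≤ m) : IsWeakDeriv U j u (iteratedDeriv j h) := by
  refine ⟨hu, (continuous_iteratedDeriv hh hj).locallyIntegrable.locallyIntegrableOn _,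
    fun φ hφ hc hs => ?_⟩
  have e : ∫ x in U, u x * iteratedDeriv j φ x = ∫ x in U, h x * iteratedDeriv j φ x := by
    refine integral_congr_ae ?_
    filter_upwards [huh] with x hx
    rw [hx]
  rw [e, setIntegral_eq_integral_of_forall_compl_eq_zero,
    setIntegral_eq_integral_of_forall_compl_eq_zero, integral_mul_iteratedDeriv hh hφ hc j hj]
  · intro x hx
    rw [image_eq_zero_of_notMem_tsupport (f := φ) fun h => hx (hs h), mul_zero]
  · intro x hx
    rw [image_eq_zero_of_notMem_tsupport (f := iteratedDeriv j φ)
      fun h => hx (hs (tsupport_iteratedDeriv_subset j φ h)), mul_zero]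

/-- The filter of essential limits is nontrivial, since no interval `(0, ε)` is null; hence the
essential limit of `w` must be the value at `0` of its continuous version. -/
theorem eq_zero_of_tendsto_ae {h w : ℝ → ℝ} {U : Set ℝ} (hU : U ∈ 𝓝[≠] (0 : ℝ))
    (hUm : MeasurableSet U) (hh : Continuous h) (hw : w =ᵐ[volume.restrict U] h)
    (hlim : Tendsto w (𝓝[≠] 0 ⊓ ae volume) (𝓝 0)) : h 0 = 0 := by
  have hne : (𝓝[≠] (0 : ℝ) ⊓ ae volume).NeBot := by
    refine inf_neBot_iff.mpr fun s hs s' hs' => ?_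
    have hs0 : s ∈ 𝓝[>] (0 : ℝ) := nhdsWithin_mono 0 (fun x hx => ne_of_gt hx) hs
    obtain ⟨ε, hε, hsub⟩ := (mem_nhdsGT_iff_exists_Ioo_subset (a := (0 : ℝ))).mp hs0
    by_contra hemp
    have hsub' : Ioo 0 ε ⊆ s'ᶜ := fun x hx hx' => hemp ⟨x, hsub hx, hx'⟩
    have h0 : volume (Ioo (0 : ℝ) ε) = 0 := measure_mono_null hsub' (mem_ae_iff.mp hs')
    rw [Real.volume_Ioo, ENNReal.ofReal_eq_zero] at h0
    have : (0 : ℝ) < ε := hε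
    linarith
  have h1 : Tendsto h (𝓝[≠] 0 ⊓ ae volume) (𝓝 (h 0)) :=
    (hh.tendsto 0).mono_left (inf_le_left.trans nhdsWithin_le_nhds)
  have h2 : Tendsto h (𝓝[≠] 0 ⊓ ae volume) (𝓝 0) := by
    refine hlim.congr' ?_
    rw [EventuallyEq, ae_restrict_iff' hUm] at hw
    filter_upwards [mem_inf_of_left hU, mem_inf_of_right hw] with x hx1 hx2
    exact hx2 hx1
  exact tendsto_nhds_unique h1 h2

/-- The derivatives at `0` vanish in the classical sense. -/
theorem VanishesAtZero.iteratedDeriv_eq_zero {k m : ℕ} {g γ : ℝ → ℝ} (hg : VanishesAtZero k g)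
    (hγ : ContDiff ℝ m γ) (hgγ : g =ᵐ[volume.restrict E] γ) {j : ℕ} (hjk : j < k) (hjm : j ≤ m) :
    iteratedDeriv j (fun t => γ (sinSq t)) 0 = 0 := by
  obtain ⟨w, hw, hlim⟩ := hg j hjk
  have hU : IsOpen (Ioo (-Real.pi) Real.pi \ {0}) := isOpen_Ioo.sdiff isClosed_singleton
  have hh : ContDiff ℝ m (fun t => γ (sinSq t)) := hγ.comp contDiff_sinSq
  have h1 : IsWeakDeriv (Ioo (-Real.pi) Real.pi \ {0}) j (fun t => g (Real.sin (t / 2) ^ 2))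
      (iteratedDeriv j (fun t => γ (sinSq t))) :=
    isWeakDeriv_of_contDiff hh hw.locInt_left (ae_comp_sinSq hgγ) hjm
  refine eq_zero_of_tendsto_ae ?_ hU.measurableSet (continuous_iteratedDeriv hh hjm)
    (hw.ae_eq hU h1) hlim
  exact sdiff_mem_nhdsWithin_compl (Ioo_mem_nhds (by simp [Real.pi_pos]) Real.pi_pos) _

end BoundaryValue

/-! ### Decay of the sine coefficients by repeated integration by parts -/

section SineCoefficients

open Real

/-- The primitive of order `i` of `t ↦ sin (ν t)` with the shifted phase. -/
def sinPrimitive (ν : ℝ) (i : ℕ) (t : ℝ) : ℝ := sin (ν * t - i * (π / 2)) / ν ^ i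

theorem hasDerivAt_sinPrimitive {ν : ℝ} (hν : ν ≠ 0) (i : ℕ) (t : ℝ) :
    HasDerivAt (sinPrimitive ν (i + 1)) (sinPrimitive ν i t) t := by
  have h := ((((hasDerivAt_id t).const_mul ν).sub_const (((i + 1 : ℕ) : ℝ) * (π / 2))).sin).div_const
    (ν ^ (i + 1))
  convert! h using 1
  have e : ν * t - i * (π / 2) = (ν * t - ((i + 1 : ℕ) : ℝ) * (π / 2)) + π / 2 := by
    push_cast; ring
  rw [sinPrimitive, e, sin_add_pi_div_two, pow_succ]
  simp only [id]
  field_simp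

theorem continuous_sinPrimitive (ν : ℝ) (i : ℕ) : Continuous (sinPrimitive ν i) := by
  unfold sinPrimitive
  fun_prop

theorem abs_sinPrimitive_le {ν : ℝ} (hν : 0 < ν) (i : ℕ) (t : ℝ) :
    |sinPrimitive ν i t| ≤ 1 / ν ^ i := by
  rw [sinPrimitive, abs_div, abs_of_pos (pow_pos hν i)]
  gcongr
  exact abs_sin_le_one _

/-- The half-integer frequency combines with an odd number of quarter-period shifts to a phase in `π
ℤ`. The primitives of odd order therefore vanish at `π`; in the other steps `u` has to. -/
theorem sinPrimitive_pi_eq_zero (n : ℕ) {i : ℕ} (hi : Even i) :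
    sinPrimitive (n + 1 / 2) (i + 1) π = 0 := by
  obtain ⟨l, rfl⟩ := hi
  have e : ((n : ℝ) + 1 / 2) * π - ((l + l + 1 : ℕ) : ℝ) * (π / 2) = ((n - l : ℤ) : ℝ) * π := by
    push_cast; ring
  rw [sinPrimitive, e, sin_int_mul_pi, zero_div]

theorem integral_mul_sinPrimitive {u w : ℝ → ℝ} (h : IsPrimitive π u w) (n i : ℕ)
    (h0 : u 0 = 0) (hπ : Odd i → u π = 0) :
    ∫ t in (0 : ℝ)..π, u t * sinPrimitive (n + 1 / 2) i t
      = -∫ t in (0 : ℝ)..π, w t * sinPrimitive (n + 1 / 2) (i + 1) t := by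
  have hν : (n : ℝ) + 1 / 2 ≠ 0 := by positivity
  rw [h.integral_mul_deriv pi_pos.le (hasDerivAt_sinPrimitive hν i) (continuous_sinPrimitive _ i),
    h0]
  rcases Nat.even_or_odd i with hi | hi
  · rw [sinPrimitive_pi_eq_zero n hi]; ring
  · rw [hπ hi]; ring

theorem abs_integral_mul_sin_le {h H : ℝ → ℝ} {m : ℕ} (hh : ContDiff ℝ m h)
    (hH : IsPrimitive π (iteratedDeriv m h) H) (h0 : ∀ j ≤ m, iteratedDeriv j h 0 = 0)
    (hπ : ∀ j, Odd j → iteratedDeriv j h π = 0) (n : ℕ) :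
    |∫ t in (0 : ℝ)..π, h t * sin ((n + 1 / 2) * t)|
      ≤ (∫ t in (0 : ℝ)..π, |H t|) / ((n : ℝ) + 1 / 2) ^ (m + 1) := by
  have hν : (0 : ℝ) < n + 1 / 2 := by positivity
  have hstep : ∀ j ≤ m, |∫ t in (0 : ℝ)..π, h t * sin ((n + 1 / 2) * t)|
      = |∫ t in (0 : ℝ)..π, iteratedDeriv j h t * sinPrimitive (n + 1 / 2) j t| := by
    intro j
    induction j with
    | zero => intro _; simp [sinPrimitive]
    | succ j ih =>
      intro hj
      have hp : IsPrimitive π (iteratedDeriv j h) (iteratedDeriv (j + 1) h) :=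
        isPrimitive_of_hasDerivAt (fun x => hasDerivAt_iteratedDeriv hh (by omega) x)
          (continuous_iteratedDeriv hh hj)
      rw [ih (by omega), integral_mul_sinPrimitive hp n j (h0 j (by omega)) (hπ j), abs_neg]
  rw [hstep m le_rfl, integral_mul_sinPrimitive hH n m (h0 m le_rfl) (hπ m), abs_neg,
    ← intervalIntegral.integral_div]
  refine (intervalIntegral.abs_integral_le_integral_abs pi_pos.le).trans ?_
  refine intervalIntegral.integral_mono_on pi_pos.le
    (hH.intervalIntegrable.mul_continuousOn (continuous_sinPrimitive _ _).continuousOn).abs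
    (hH.intervalIntegrable.abs.div_const _) fun t _ => ?_
  rw [abs_mul, div_eq_mul_one_div |H t|]
  exact mul_le_mul_of_nonneg_left (abs_sinPrimitive_le hν _ _) (abs_nonneg _)

theorem integral_congr_comp_sinSq {u v : ℝ → ℝ} (h : u =ᵐ[volume.restrict E] v) (F : ℝ → ℝ → ℝ) :
    ∫ t in (0 : ℝ)..π, F (u (sinSq t)) t = ∫ t in (0 : ℝ)..π, F (v (sinSq t)) t := by
  rw [intervalIntegral.integral_of_le pi_pos.le, intervalIntegral.integral_of_le pi_pos.le,
    integral_Ioc_eq_integral_Ioo, integral_Ioc_eq_integral_Ioo]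
  refine integral_congr_ae ?_
  filter_upwards [measurePreserving_sinSq.quasiMeasurePreserving.ae
    (mu_absolutelyContinuous.ae_le h)] with t ht
  rw [ht]

theorem integral_abs_sum_chainCoeff_le (m : ℕ) {G : ℕ → ℝ → ℝ}
    (hG : ∀ j ≤ m + 1, MemLp (G j) 2 mu) :
    ∫ t in (0 : ℝ)..π, |∑ j ∈ Finset.range (m + 2), chainCoeff (m + 1) j t * G j (sinSq t)|
      ≤ (m + 1).factorial * (√π * ∑ j ∈ Finset.range (m + 2), normL2mu (G j)) := by
  have hj : ∀ j ∈ Finset.range (m + 2), MemLp (G j) 2 mu := fun j hj =>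
    hG j (by have := Finset.mem_range.mp hj; omega)
  have hint : ∀ j ∈ Finset.range (m + 2),
      IntegrableOn (fun t => (m + 1).factorial * |G j (sinSq t)|) (Ioo 0 π) :=
    fun j h => (integrable_comp_sinSq (hj j h)).abs.const_mul _
  rw [intervalIntegral.integral_of_le pi_pos.le, integral_Ioc_eq_integral_Ioo]
  calc ∫ t in Ioo 0 π, |∑ j ∈ Finset.range (m + 2), chainCoeff (m + 1) j t * G j (sinSq t)|
      ≤ ∫ t in Ioo 0 π, ∑ j ∈ Finset.range (m + 2), (m + 1).factorial * |G j (sinSq t)| := by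
        refine integral_mono_of_nonneg (Eventually.of_forall fun _ => abs_nonneg _)
          (integrable_finsetSum _ hint) (Eventually.of_forall fun t => ?_)
        refine (Finset.abs_sum_le_sum_abs _ _).trans (Finset.sum_le_sum fun j _ => ?_)
        rw [abs_mul]
        gcongr
        exact abs_chainCoeff_le _ _ _
    _ = ∑ j ∈ Finset.range (m + 2), (m + 1).factorial * ∫ t in Ioo 0 π, |G j (sinSq t)| := by
        rw [integral_finsetSum _ hint]
        simp_rw [integral_const_mul]
    _ ≤ _ := by
        rw [Finset.mul_sum, Finset.mul_sum]
        refine Finset.sum_le_sum fun j h => ?_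
        gcongr
        exact integral_norm_comp_sinSq_le (hj j h)

theorem MemSobolev.isWeakDeriv {k : ℕ} {g : ℝ → ℝ} (hg : MemSobolev k g) {j : ℕ} (hj : j ≤ k) :
    IsWeakDeriv E j g (weakDeriv E j g) := by
  obtain ⟨w, hw, -⟩ := hg j hj
  have hex : ∃ w, IsWeakDeriv E j g w := ⟨w, hw⟩
  rw [weakDeriv, dif_pos hex]
  exact hex.choose_spec

theorem MemSobolev.memLp {k : ℕ} {g : ℝ → ℝ} (hg : MemSobolev k g) {j : ℕ} (hj : j ≤ k) :
    MemLp (weakDeriv E j g) 2 mu := by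
  obtain ⟨w, hw, hw2⟩ := hg j hj
  exact (memLp_congr_ae (mu_absolutelyContinuous.ae_le
    (hw.weakDeriv_ae_eq isOpen_E))).mpr hw2

theorem integrableOn_of_memLp_mu {w : ℝ → ℝ} (hw : MemLp w 2 mu) : IntegrableOn w E :=
  (hw.integrable (by norm_num)).mono_measure restrict_E_le_mu

theorem IsWeakDeriv.ae_eq_self {g w : ℝ → ℝ} (h : IsWeakDeriv E 0 g w) :
    w =ᵐ[volume.restrict E] g :=
  h.ae_eq isOpen_E ⟨h.locInt_left, h.locInt_left, fun φ _ _ _ => by simp⟩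

/-- The decay of the sine coefficients of `g (sin² (t / 2))`. -/
theorem abs_integral_comp_sinSq_mul_sin_le {k : ℕ} (hk : 0 < k) {g : ℝ → ℝ} (hg : MemSobolev k g)
    (hg₀ : VanishesAtZero k g) (n : ℕ) :
    |∫ t in (0 : ℝ)..π, g (sinSq t) * sin ((n + 1 / 2) * t)|
      ≤ k.factorial * (√π * sobolevNorm k g) / ((n : ℝ) + 1 / 2) ^ k := by
  -- The representative of `g` is of class `C^m`; the derivative of order `k = m + 1` exists only as
  -- an integrable function.
  obtain ⟨m, rfl⟩ : ∃ m, k = m + 1 := ⟨k - 1, by omega⟩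
  set w : ℕ → ℝ → ℝ := fun j => weakDeriv E j g
  have hwint : ∀ j ≤ m + 1, IntegrableOn (w j) E := fun j hj =>
    integrableOn_of_memLp_mu (hg.memLp hj)
  have hw1 : ∀ j < m + 1, IsWeakDeriv E 1 (w j) (w (j + 1)) := fun j hj =>
    (hg.isWeakDeriv (by omega)).succ_of_eq (hg.isWeakDeriv (by omega))
  obtain ⟨c, hc⟩ := (hw1 m (by omega)).exists_eq_primitive (hwint m (by omega))
    (hwint (m + 1) le_rfl)
  -- Extension by zero makes the primitive `F` continuous on the whole line, so that `γ` and the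
  -- chain rule are global.
  set W : ℝ → ℝ := indicator E (w (m + 1))
  have hWw : W =ᵐ[volume.restrict E] w (m + 1) := indicator_ae_eq_restrict isOpen_E.measurableSet
  have hWint : Integrable W := (integrable_indicator_iff isOpen_E.measurableSet).mpr
    (hwint (m + 1) le_rfl)
  set F : ℝ → ℝ := fun x => c + ∫ y in (0 : ℝ)..x, W y
  have hF : Continuous F := continuous_const.add
    (intervalIntegral.continuous_primitive (fun a b => hWint.intervalIntegrable) 0)
  have hwF : w m =ᵐ[volume.restrict E] F := by
    filter_upwards [hc, ae_restrict_mem isOpen_E.measurableSet] with x hx hxE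
    rw [hx]
    simp only [F]
    congr 1
    refine intervalIntegral.integral_congr_ae (Eventually.of_forall fun y hy => ?_)
    rw [uIoc_of_le hxE.1.le] at hy
    exact (indicator_of_mem (show y ∈ E from ⟨hy.1, hy.2.trans_lt hxE.2⟩) _).symm
  obtain ⟨γ, hγ, hγw, hγm⟩ := exists_contDiff_representative m w
    (fun j hj => hwint j (by omega)) (fun j hj => hw1 j (by omega)) hF hwF
  have hgγ : g =ᵐ[volume.restrict E] γ := by
    have h1 := hγw 0 (by omega)
    rw [iteratedDeriv_zero] at h1
    exact (hg.isWeakDeriv (by omega)).ae_eq_self.symm.trans h1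
  have hprim : IsPrimitive 1 (iteratedDeriv m γ) W := by
    refine ⟨hWint.intervalIntegrable, fun x _ => ?_⟩
    rw [hγm]
    simp [F]
  -- The classical derivatives, completed by `W` at the top order; almost everywhere on `E` they are
  -- the weak derivatives of `g`, so the norms agree.
  set G : ℕ → ℝ → ℝ := fun j => if j ≤ m then iteratedDeriv j γ else W
  have hGw : ∀ j ≤ m + 1, G j =ᵐ[volume.restrict E] w j := by
    intro j hj
    by_cases h : j ≤ m
    · simp only [G, h, if_true]
      exact (hγw j h).symm
    · obtain rfl : j = m + 1 := by omega
      simpa [G] using hWw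
  have hGL : ∀ j ≤ m + 1, MemLp (G j) 2 mu := fun j hj =>
    (memLp_congr_ae (mu_absolutelyContinuous.ae_le (hGw j hj))).mpr (hg.memLp hj)
  have hGn : ∑ j ∈ Finset.range (m + 2), normL2mu (G j) = sobolevNorm (m + 1) g := by
    refine Finset.sum_congr rfl fun j hj => ?_
    rw [normL2mu, normL2mu, eLpNorm_congr_ae (mu_absolutelyContinuous.ae_le
      (hGw j (by have := Finset.mem_range.mp hj; omega)))]
  have hH := isPrimitive_iteratedDeriv_comp_sinSq hγ hprim (G := G)
    (fun j hj => by simp [G, hj]) (by simp [G])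
  have key := abs_integral_mul_sin_le (hγ.comp contDiff_sinSq) hH
    (fun j hj => hg₀.iteratedDeriv_eq_zero hγ hgγ (by omega) hj)
    (fun j hj => iteratedDeriv_comp_sinSq_pi γ hj) n
  rw [integral_congr_comp_sinSq hgγ (fun y t => y * sin ((n + 1 / 2) * t))]
  refine key.trans ?_
  gcongr
  rw [← hGn]
  exact integral_abs_sum_chainCoeff_le m hGL

end SineCoefficients

/-! ### The Mehler–Dirichlet formula and the Legendre coefficients of `f` -/

section Mehler

open Polynomial Real

/-- The polynomial `S_n` with `sin ((2n+1) θ) = sin θ * S_n (cos² θ)`. -/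
def sineP (n : ℕ) : ℝ[X] :=
  ∑ m ∈ Finset.range (n + 1), C ((-1) ^ (n + m) * ((n + m).choose (2 * m) : ℝ) * 4 ^ m) * X ^ m

theorem coeff_sineP (n m : ℕ) :
    (sineP n).coeff m = (-1) ^ (n + m) * ((n + m).choose (2 * m) : ℝ) * 4 ^ m := by
  rw [sineP, finsetSum_coeff]
  simp_rw [coeff_C_mul_X_pow]
  rw [Finset.sum_ite_eq]
  split_ifs with h
  · rfl
  · rw [Finset.mem_range, not_lt] at h
    rw [Nat.choose_eq_zero_of_lt (by omega)]
    simp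

theorem choose_add_two_eq (n m : ℕ) :
    (n + 2 + (m + 1)).choose (2 * (m + 1)) + (n + (m + 1)).choose (2 * (m + 1))
      = (n + 1 + m).choose (2 * m) + 2 * (n + 1 + (m + 1)).choose (2 * (m + 1)) := by
  have e1 : n + 2 + (m + 1) = n + m + 1 + 1 + 1 := by ring
  have e2 : n + (m + 1) = n + m + 1 := by ring
  have e3 : n + 1 + m = n + m + 1 := by ring
  have e4 : n + 1 + (m + 1) = n + m + 1 + 1 := by ring
  have e5 : 2 * (m + 1) = 2 * m + 1 + 1 := by ring
  rw [e1, e2, e3, e4, e5, Nat.choose_succ_succ (n + m + 1 + 1), Nat.choose_succ_succ (n + m + 1),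
    Nat.choose_succ_succ (n + m + 1) (2 * m + 1)]
  ring

/-- The counterpart of `sin ((2n+5)θ) = 2 cos (2θ) sin ((2n+3)θ) - sin ((2n+1)θ)`, with `2 cos (2θ)
= 4 cos² θ - 2`. On coefficients it is Pascal's rule applied repeatedly. -/
theorem sineP_add_two (n : ℕ) :
    sineP (n + 2) = (C 4 * X - C 2) * sineP (n + 1) - sineP n := by
  ext m
  rw [sub_mul, coeff_sub, coeff_sub, mul_assoc, coeff_C_mul, coeff_C_mul]
  rcases m with _ | m
  · rw [coeff_X_mul_zero]
    simp only [coeff_sineP]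
    simp [pow_succ]
    ring
  · rw [coeff_X_mul]
    simp only [coeff_sineP]
    have h := congrArg (Nat.cast (R := ℝ)) (choose_add_two_eq n m)
    push_cast at h
    have e : (((n + 2 + (m + 1)).choose (2 * (m + 1)) : ℕ) : ℝ)
        = (n + 1 + m).choose (2 * m) + 2 * (n + 1 + (m + 1)).choose (2 * (m + 1))
          - (n + (m + 1)).choose (2 * (m + 1)) := by linarith
    rw [e]
    ring

theorem sin_mul_eval_sineP (n : ℕ) (θ : ℝ) :
    sin ((2 * n + 1) * θ) = sin θ * (sineP n).eval (cos θ ^ 2) := by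
  induction n using Nat.twoStepInduction with
  | zero => simp [sineP]
  | one =>
    have : (sineP 1).eval (cos θ ^ 2) = 4 * cos θ ^ 2 - 1 := by
      simp [sineP, Finset.sum_range_succ]; ring
    rw [this]
    have h3 : ((2 : ℝ) * (1 : ℕ) + 1) * θ = 3 * θ := by push_cast; ring
    rw [h3, sin_three_mul, cos_sq']
    ring
  | more n ih0 ih1 =>
    have e1 : (2 * ((n + 2 : ℕ) : ℝ) + 1) * θ = (2 * ((n + 1 : ℕ) : ℝ) + 1) * θ + 2 * θ := by
      push_cast; ring
    have e0 : (2 * (n : ℝ) + 1) * θ = (2 * ((n + 1 : ℕ) : ℝ) + 1) * θ - 2 * θ := by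
      push_cast; ring
    rw [e0, sin_sub] at ih0
    rw [e1, sin_add, sineP_add_two]
    simp only [eval_sub, eval_mul, eval_C, eval_X]
    have h2 : cos (2 * θ) = 2 * cos θ ^ 2 - 1 := cos_two_mul θ
    rw [show sin ((2 * ((n + 1 : ℕ) : ℝ) + 1) * θ) * cos (2 * θ)
        + cos ((2 * ((n + 1 : ℕ) : ℝ) + 1) * θ) * sin (2 * θ)
        = 2 * cos (2 * θ) * sin ((2 * ((n + 1 : ℕ) : ℝ) + 1) * θ)
          - (sin ((2 * ((n + 1 : ℕ) : ℝ) + 1) * θ) * cos (2 * θ)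
            - cos ((2 * ((n + 1 : ℕ) : ℝ) + 1) * θ) * sin (2 * θ)) by ring, ih0, ih1, h2]
    ring

theorem integral_sin_pow_two_mul (m : ℕ) :
    ∫ t in (0 : ℝ)..π / 2, sin t ^ (2 * m) = π / 2 * (m.centralBinom / 4 ^ m) := by
  induction m with
  | zero => simp
  | succ m ih =>
    have h := Nat.succ_mul_centralBinom_succ m
    have h' : ((m : ℝ) + 1) * (m + 1).centralBinom = 2 * (2 * m + 1) * m.centralBinom := by
      exact_mod_cast h
    have hc : ((m + 1).centralBinom : ℝ) = 2 * (2 * m + 1) * m.centralBinom / (m + 1) := by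
      rw [eq_div_iff (by positivity)]
      linarith
    rw [show 2 * (m + 1) = 2 * m + 2 by ring, integral_sin_pow, ih, hc]
    simp only [sin_zero, cos_pi_div_two, mul_zero, ne_eq, Nat.add_eq_zero_iff, one_ne_zero,
      and_false, not_false_eq_true, zero_pow, zero_mul, sub_self, zero_div, zero_add]
    have : (m : ℝ) + 1 ≠ 0 := by positivity
    push_cast
    field_simp
    ring

theorem integral_sinSq_pow (m : ℕ) :
    ∫ t in Ioo 0 π, sinSq t ^ m = π * (m.centralBinom / 4 ^ m) := by
  rw [← integral_Ioc_eq_integral_Ioo, ← intervalIntegral.integral_of_le pi_pos.le]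
  have e : ∀ t, sinSq t ^ m = (fun s => sin s ^ (2 * m)) (t / 2) := by
    intro t; simp only [sinSq, pow_mul]
  simp_rw [e]
  rw [intervalIntegral.integral_comp_div (fun s => sin s ^ (2 * m)) two_ne_zero, zero_div,
    integral_sin_pow_two_mul, smul_eq_mul]
  ring

theorem choose_mul_centralBinom (n m : ℕ) :
    (n + m).choose (2 * m) * m.centralBinom = n.choose m * (n + m).choose n := by
  rcases lt_or_ge n m with h | h
  · rw [Nat.choose_eq_zero_of_lt (show n + m < 2 * m by omega), Nat.choose_eq_zero_of_lt h]
    simp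
  · rw [Nat.centralBinom_eq_two_mul_choose, Nat.choose_mul,
      show n + m - m = n by omega, show 2 * m - m = m by omega, mul_comm,
      Nat.choose_symm_add]
    omega

/-- Comparison of coefficients in powers of `1 - y`: Wallis' moments cancel the factors `4^m`, and
`choose_mul_centralBinom` identifies what is left with the Legendre coefficients, after the
reflection `y ↦ 1 - y`. -/
theorem integral_eval_sineP (n : ℕ) (y : ℝ) :
    ∫ t in Ioo 0 π, (sineP n).eval ((1 - y) * sinSq t) = π * (realShiftedLegendre n).eval y := by
  have hdeg : (sineP n).natDegree < n + 1 := by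
    rw [Nat.lt_succ_iff, natDegree_le_iff_coeff_eq_zero]
    intro m hm
    rw [coeff_sineP, Nat.choose_eq_zero_of_lt (by omega)]
    simp
  have hcont : ∀ m : ℕ, IntegrableOn
      (fun t => (sineP n).coeff m * (1 - y) ^ m * sinSq t ^ m) (Ioo 0 π) := fun m =>
    (Continuous.integrableOn_Icc
      (continuous_const.mul ((contDiff_sinSq (n := 0)).continuous.pow m))).mono_set
      Ioo_subset_Icc_self
  have hsymm := realShiftedLegendre_eval_one_sub n (1 - y)
  rw [sub_sub_cancel] at hsymm
  rw [← hsymm, eval_eq_sum_range' (p := realShiftedLegendre n) (n := n + 1)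
    (by rw [natDegree_realShiftedLegendre]; omega)]
  simp_rw [eval_eq_sum_range' hdeg, mul_pow, ← mul_assoc]
  rw [integral_finsetSum _ (fun m _ => hcont m), Finset.mul_sum]
  refine Finset.sum_congr rfl fun m _ => ?_
  rw [integral_const_mul, integral_sinSq_pow, coeff_sineP, coeff_realShiftedLegendre]
  have h := congrArg (Nat.cast (R := ℝ)) (choose_mul_centralBinom n m)
  push_cast at h
  have h4 : (4 : ℝ) ^ m ≠ 0 := by positivity
  field_simp
  linear_combination ((-1) ^ (n + m) * (1 - y) ^ m) * h

theorem image_one_sub_mul_sinSq {y : ℝ} (hy : y ∈ E) :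
    (fun t => 1 - (1 - y) * sinSq t) '' Ioo 0 π = Ioo y 1 := by
  have hz : 0 < 1 - y := by linarith [hy.2]
  have : (fun t => 1 - (1 - y) * sinSq t) '' Ioo 0 π
      = (fun u => 1 - (1 - y) * u) '' E := by
    rw [← image_sinSq_pi, image_image]
  rw [this]
  ext x
  constructor
  · rintro ⟨u, hu, rfl⟩
    have := mul_pos hz hu.1
    have := mul_pos hz (sub_pos.mpr hu.2)
    constructor <;> simp only <;> linarith
  · intro hx
    refine ⟨(1 - x) / (1 - y), ⟨div_pos (by linarith [hx.2]) hz, ?_⟩, ?_⟩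
    · rw [div_lt_one hz]; linarith [hx.1]
    · simp only
      field_simp
      ring

/-- The kernel of the Mehler–Dirichlet formula. -/
def mehlerKernel (y x : ℝ) : ℝ := if y < x then 1 / (√(x - y) * √(1 - x)) else 0

theorem mehlerKernel_nonneg (y x : ℝ) : 0 ≤ mehlerKernel y x := by
  unfold mehlerKernel
  split_ifs <;> positivity

theorem measurable_mehlerKernel : Measurable (Function.uncurry mehlerKernel) := by
  unfold mehlerKernel Function.uncurry
  refine Measurable.ite (measurableSet_lt measurable_fst measurable_snd) ?_ measurable_const
  fun_prop

/-- With `x = 1 - (1 - y) sin² (t/2)` one has `x - y = (1 - y) cos² (t/2)` and `1 - x = (1 - y) sin²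
(t/2)`, so the kernel is the reciprocal of the Jacobian. -/
theorem mehlerKernel_comp {y t : ℝ} (hy : y ∈ E) (ht : t ∈ Ioo 0 π) :
    |-((1 - y) * (sin t / 2))| * mehlerKernel y (1 - (1 - y) * sinSq t) = 1 := by
  have hz : 0 < 1 - y := by linarith [hy.2]
  have hp : 0 < sin t / 2 := half_pos (sin_pos_of_mem ht)
  have hmem : 1 - (1 - y) * sinSq t ∈ Ioo y 1 := by
    rw [← image_one_sub_mul_sinSq hy]
    exact mem_image_of_mem _ ht
  have h1 : 0 ≤ sinSq t := (sinSq_mem_Icc t).1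
  have h2 : 0 ≤ 1 - sinSq t := by linarith [(sinSq_mem_Icc t).2]
  have e : √(1 - (1 - y) * sinSq t - y) * √(1 - (1 - (1 - y) * sinSq t))
      = (1 - y) * (sin t / 2) := by
    rw [← sqrt_mul (by linarith [hmem.1]), show (1 - (1 - y) * sinSq t - y)
      * (1 - (1 - (1 - y) * sinSq t)) = (1 - y) ^ 2 * (sinSq t * (1 - sinSq t)) by ring,
      sqrt_mul (by positivity), sqrt_sq hz.le, sqrt_sinSq_mul, abs_of_pos hp]
  rw [mehlerKernel, if_pos hmem.1, e, abs_neg, abs_of_pos (mul_pos hz hp),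
    mul_one_div_cancel (mul_pos hz hp).ne']

theorem hasDerivAt_one_sub_mul_sinSq (y t : ℝ) :
    HasDerivAt (fun t => 1 - (1 - y) * sinSq t) (-((1 - y) * (sin t / 2))) t :=
  ((hasDerivAt_sinSq t).const_mul (1 - y)).const_sub 1

theorem injOn_one_sub_mul_sinSq {y : ℝ} (hy : y ∈ E) :
    InjOn (fun t => 1 - (1 - y) * sinSq t) (Ioo 0 π) := by
  intro s hs t ht h
  have hz : 1 - y ≠ 0 := by linarith [hy.2]
  simp only [sub_right_inj] at h
  exact injOn_sinSq (Ioo_subset_Icc_self hs) (Ioo_subset_Icc_self ht) (mul_left_cancel₀ hz h)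

theorem mehlerKernel_mul_eq_indicator {y : ℝ} (hy : y ∈ E) (ψ : ℝ → ℝ) :
    E.indicator (fun x => mehlerKernel y x * ψ x)
      = (Ioo y 1).indicator (fun x => mehlerKernel y x * ψ x) := by
  funext x
  by_cases h : y < x
  · by_cases h1 : x < 1
    · rw [indicator_of_mem (show x ∈ E from ⟨hy.1.trans h, h1⟩),
        indicator_of_mem (show x ∈ Ioo y 1 from ⟨h, h1⟩)]
    · rw [indicator_of_notMem (fun hx : x ∈ E => h1 hx.2),
        indicator_of_notMem (fun hx : x ∈ Ioo y 1 => h1 hx.2)]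
  · have : mehlerKernel y x = 0 := if_neg h
    simp [indicator, this]

theorem integral_mehlerKernel_mul {y : ℝ} (hy : y ∈ E) (ψ : ℝ → ℝ) :
    ∫ x in E, mehlerKernel y x * ψ x = ∫ t in Ioo 0 π, ψ (1 - (1 - y) * sinSq t) := by
  rw [← integral_indicator isOpen_E.measurableSet, mehlerKernel_mul_eq_indicator hy,
    integral_indicator measurableSet_Ioo, ← image_one_sub_mul_sinSq hy,
    integral_image_eq_integral_abs_deriv_smul measurableSet_Ioo
      (fun t _ => (hasDerivAt_one_sub_mul_sinSq y t).hasDerivWithinAt) (injOn_one_sub_mul_sinSq hy)]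
  refine setIntegral_congr_fun measurableSet_Ioo fun t ht => ?_
  simp only [smul_eq_mul]
  rw [← mul_assoc, mehlerKernel_comp hy ht, one_mul]

theorem integrableOn_mehlerKernel_mul {y : ℝ} (hy : y ∈ E) {ψ : ℝ → ℝ} (hψ : Continuous ψ) :
    IntegrableOn (fun x => mehlerKernel y x * ψ x) E := by
  rw [← integrable_indicator_iff isOpen_E.measurableSet, mehlerKernel_mul_eq_indicator hy,
    integrable_indicator_iff measurableSet_Ioo, ← image_one_sub_mul_sinSq hy,
    integrableOn_image_iff_integrableOn_abs_deriv_smul measurableSet_Ioo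
      (fun t _ => (hasDerivAt_one_sub_mul_sinSq y t).hasDerivWithinAt) (injOn_one_sub_mul_sinSq hy)]
  have hc : IntegrableOn (fun t => ψ (1 - (1 - y) * sinSq t)) (Ioo 0 π) :=
    (Continuous.integrableOn_Icc (hψ.comp (continuous_const.sub
      (continuous_const.mul (contDiff_sinSq (n := 0)).continuous)))).mono_set Ioo_subset_Icc_self
  refine hc.congr_fun (fun t ht => ?_) measurableSet_Ioo
  simp only [smul_eq_mul]
  rw [← mul_assoc, mehlerKernel_comp hy ht, one_mul]

/-- The Mehler–Dirichlet formula. -/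
theorem integral_mehlerKernel_mul_sineP (n : ℕ) {y : ℝ} (hy : y ∈ E) :
    ∫ x in E, mehlerKernel y x * (sineP n).eval (1 - x) = π * (realShiftedLegendre n).eval y := by
  rw [integral_mehlerKernel_mul hy (fun x => (sineP n).eval (1 - x)), ← integral_eval_sineP]
  simp_rw [sub_sub_cancel]

/-- Justifies Fubini: the kernel has mass `π` in `x` for every `y`, so integrability of `f`
suffices. -/
theorem integrable_mul_mehlerKernel_mul {f ψ : ℝ → ℝ} (hf : IntegrableOn f E) (hψ : Continuous ψ) :
    Integrable (Function.uncurry fun y x => f y * (mehlerKernel y x * ψ x))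
      ((volume.restrict E).prod (volume.restrict E)) := by
  have hmeas : AEStronglyMeasurable (Function.uncurry fun y x => f y * (mehlerKernel y x * ψ x))
      ((volume.restrict E).prod (volume.restrict E)) := by
    refine AEStronglyMeasurable.mul (f := fun p : ℝ × ℝ => f p.1)
      (g := fun p : ℝ × ℝ => mehlerKernel p.1 p.2 * ψ p.2) hf.aestronglyMeasurable.comp_fst ?_
    exact (measurable_mehlerKernel.mul (hψ.measurable.comp measurable_snd)).aestronglyMeasurable
  obtain ⟨C, hC⟩ := (isCompact_Icc (a := (0 : ℝ)) (b := 1)).exists_bound_of_continuousOn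
    hψ.continuousOn
  have hE := ae_restrict_mem (μ := (volume : Measure ℝ)) isOpen_E.measurableSet
  rw [integrable_prod_iff hmeas]
  refine ⟨?_, ?_⟩
  · filter_upwards [hE] with y hy
    exact (integrableOn_mehlerKernel_mul hy hψ).const_mul (f y)
  · refine (hf.norm.mul_const (C * π)).mono' hmeas.norm.integral_prod_right' ?_
    filter_upwards [hE] with y hy
    rw [Real.norm_of_nonneg (integral_nonneg fun _ => norm_nonneg _)]
    have h1 : ∫ x in E, mehlerKernel y x * C = C * π := by
      rw [integral_mehlerKernel_mul hy (fun _ => C)]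
      simp [pi_pos.le, mul_comm]
    rw [← h1, ← integral_const_mul]
    refine integral_mono_of_nonneg (Eventually.of_forall fun _ => norm_nonneg _)
      ((integrableOn_mehlerKernel_mul hy continuous_const).const_mul _) ?_
    filter_upwards [hE] with x hx
    simp only [Function.uncurry]
    rw [norm_mul, norm_mul, Real.norm_of_nonneg (mehlerKernel_nonneg y x)]
    have := hC x (Ioo_subset_Icc_self hx)
    have := mehlerKernel_nonneg y x
    gcongr

theorem integral_mul_mehlerKernel (f : ℝ → ℝ) {x : ℝ} (hx : x ∈ E) :
    ∫ y in E, f y * mehlerKernel y x = abelTransform f x / √(1 - x) := by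
  rw [abelTransform, intervalIntegral.integral_of_le hx.1.le, integral_Ioc_eq_integral_Ioo,
    ← integral_div, ← integral_indicator isOpen_E.measurableSet,
    ← integral_indicator measurableSet_Ioo]
  congr 1
  funext y
  by_cases h : y < x
  · by_cases h0 : 0 < y
    · rw [indicator_of_mem (show y ∈ E from ⟨h0, h.trans hx.2⟩),
        indicator_of_mem (show y ∈ Ioo 0 x from ⟨h0, h⟩), mehlerKernel, if_pos h]
      simp only [div_eq_mul_inv, mul_inv]
      ring
    · rw [indicator_of_notMem (fun hy : y ∈ E => h0 hy.1),
        indicator_of_notMem (fun hy : y ∈ Ioo 0 x => h0 hy.1)]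
  · rw [indicator_of_notMem (fun hy : y ∈ Ioo 0 x => h hy.2)]
    have : mehlerKernel y x = 0 := if_neg h
    simp [indicator, this]

/-- The Legendre coefficients of `f` are sine coefficients of the Abel transform of `f`. -/
theorem legendreCoeff_eq_integral_sin {f : ℝ → ℝ} (hf : IntegrableOn f E) (n : ℕ) :
    legendreCoeff f n = √(2 * n + 1) * (-1) ^ n / π
      * ∫ t in (0 : ℝ)..π, abelTransform f (sinSq t) * sin ((n + 1 / 2) * t) := by
  have hψ : Continuous fun x => (sineP n).eval (1 - x) :=
    (sineP n).continuous.comp (continuous_const.sub continuous_id)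
  have h1 : legendreCoeff f n = √(2 * n + 1) * (-1) ^ n / π
      * ∫ y in E, ∫ x in E, f y * (mehlerKernel y x * (sineP n).eval (1 - x)) := by
    rw [legendreCoeff, ← integral_restrict_E, ← integral_const_mul]
    refine setIntegral_congr_fun isOpen_E.measurableSet fun y hy => ?_
    rw [integral_const_mul, integral_mehlerKernel_mul_sineP n hy, shiftedP_eq]
    field_simp
  rw [h1, integral_integral_swap (integrable_mul_mehlerKernel_mul hf hψ)]
  congr 1
  rw [intervalIntegral.integral_of_le pi_pos.le, integral_Ioc_eq_integral_Ioo]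
  have h2 : ∫ x in E, ∫ y in E, f y * (mehlerKernel y x * (sineP n).eval (1 - x))
      = ∫ x in E, abelTransform f x / √(1 - x) * (sineP n).eval (1 - x) := by
    refine setIntegral_congr_fun isOpen_E.measurableSet fun x hx => ?_
    rw [← integral_mul_mehlerKernel f hx, ← integral_mul_const]
    simp_rw [mul_assoc]
  rw [h2, ← image_sinSq_pi, integral_image_eq_integral_abs_deriv_smul measurableSet_Ioo
      (fun t _ => (hasDerivAt_sinSq t).hasDerivWithinAt)
      (injOn_sinSq.mono Ioo_subset_Icc_self)]
  refine setIntegral_congr_fun measurableSet_Ioo fun t ht => ?_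
  have hp : 0 < sin t / 2 := half_pos (sin_pos_of_mem ht)
  have hc : 0 < cos (t / 2) := cos_pos_of_mem_Ioo ⟨by linarith [ht.1, pi_pos], by linarith [ht.2]⟩
  have hs : sin t = 2 * sin (t / 2) * cos (t / 2) := by
    rw [← sin_two_mul]; congr 1; ring
  have h3 := sin_mul_eval_sineP n (t / 2)
  rw [show (2 * (n : ℝ) + 1) * (t / 2) = (n + 1 / 2) * t by ring] at h3
  simp only [smul_eq_mul]
  -- The denominator `√(1 - x) = cos (t/2)` cancels against the Jacobian `sin (t/2) cos (t/2)`; the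
  -- remaining `sin (t/2)` completes `sineP` to the sine.
  rw [abs_of_pos hp, one_sub_sinSq, sqrt_sq hc.le, h3, hs]
  field_simp

end Mehler

/-! ### Tail of the coefficient series and comparison of constants -/

section TailEstimate

open Real

/-- Telescoping: `2/n³ ≤ 1/((n-1)n) - 1/(n(n+1))`. -/
theorem sum_two_mul_inv_pow_le (N : ℕ) (hN : 1 ≤ N) (M : ℕ) :
    ∑ n ∈ Finset.range M, (if n ≤ N then 0 else 2 / (n : ℝ) ^ 3) ≤ 1 / (N : ℝ) ^ 2 := by
  have hN' : (1 : ℝ) ≤ N := by exact_mod_cast hN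
  have key : ∀ M, N + 1 ≤ M → ∑ n ∈ Finset.range M, (if n ≤ N then 0 else 2 / (n : ℝ) ^ 3)
      ≤ 1 / ((N : ℝ) * (N + 1)) - 1 / (((M : ℝ) - 1) * M) := by
    intro M hM
    induction M, hM using Nat.le_induction with
    | base =>
      rw [Finset.sum_eq_zero]
      · push_cast; rw [add_sub_cancel_right, sub_self]
      · intro n hn
        rw [if_pos (Nat.lt_succ_iff.mp (Finset.mem_range.mp hn))]
    | succ M hM ih =>
      rw [Finset.sum_range_succ, if_neg (by omega)]
      have hM2 : (2 : ℝ) ≤ M := by exact_mod_cast (by omega : 2 ≤ M)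
      have h1 : (0 : ℝ) < (M : ℝ) - 1 := by linarith
      have : 2 / (M : ℝ) ^ 3 ≤ 1 / (((M : ℝ) - 1) * M) - 1 / (((M + 1 : ℕ) : ℝ) - 1) / (M + 1 : ℕ) := by
        push_cast
        rw [add_sub_cancel_right, div_div, div_sub_div _ _ (by positivity) (by positivity),
          div_le_div_iff₀ (by positivity) (by positivity)]
        have : (0 : ℝ) < M := by linarith
        nlinarith [pow_pos this 2]
      rw [div_div] at this
      linarith
  have hle : 1 / ((N : ℝ) * (N + 1)) ≤ 1 / (N : ℝ) ^ 2 := by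
    apply one_div_le_one_div_of_le (by positivity)
    nlinarith
  rcases le_or_gt (N + 1) M with h | h
  · have hM2 : (2 : ℝ) ≤ M := by exact_mod_cast (by omega : 2 ≤ M)
    have : 0 ≤ 1 / (((M : ℝ) - 1) * M) := by
      apply one_div_nonneg.mpr
      apply mul_nonneg <;> linarith
    linarith [key M h]
  · rw [Finset.sum_eq_zero]
    · positivity
    · intro n hn
      rw [if_pos]
      have := Finset.mem_range.mp hn
      omega

/-- The tail of the series of squares of coefficients with the decay rate of order `k`. -/
theorem sum_sq_le_of_decay {k N : ℕ} (hk : 1 < k) (hN : 1 ≤ N) {a : ℕ → ℝ} {B : ℝ}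
    (ha : ∀ n, |a n| ≤ √(2 * n + 1) * B / ((n : ℝ) + 1 / 2) ^ k) (M : ℕ) :
    ∑ n ∈ Finset.range M, (if n ≤ N then 0 else a n ^ 2) ≤ (B / (N : ℝ) ^ (k - 1)) ^ 2 := by
  obtain ⟨l, rfl⟩ : ∃ l, k = l + 2 := ⟨k - 2, by omega⟩
  have hN' : (0 : ℝ) < N := by exact_mod_cast hN
  have hterm : ∀ n, (if n ≤ N then 0 else a n ^ 2)
      ≤ B ^ 2 / (N : ℝ) ^ (2 * l) * (if n ≤ N then 0 else 2 / (n : ℝ) ^ 3) := by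
    intro n
    split_ifs with h
    · simp
    · have hn : (N : ℝ) ≤ n := by exact_mod_cast (by omega : N ≤ n)
      have hn0 : (0 : ℝ) < n := hN'.trans_le hn
      have h1 : a n ^ 2 ≤ (√(2 * n + 1) * B / ((n : ℝ) + 1 / 2) ^ (l + 2)) ^ 2 := by
        rw [← sq_abs (a n)]
        exact pow_le_pow_left₀ (abs_nonneg _) (ha n) 2
      refine h1.trans ?_
      rw [div_pow, mul_pow, sq_sqrt (by positivity)]
      have e : (2 * (n : ℝ) + 1) * B ^ 2 / (((n : ℝ) + 1 / 2) ^ (l + 2)) ^ 2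
          = 2 * B ^ 2 / ((n : ℝ) + 1 / 2) ^ (2 * l + 3) := by
        rw [div_eq_div_iff (by positivity) (by positivity)]
        ring
      rw [e, div_mul_div_comm, mul_comm (B ^ 2)]
      apply div_le_div_of_nonneg_left (by positivity) (by positivity)
      -- Of the `2l + 3` factors `n + 1/2`, `2l` are bounded below by `N` and three by `n`, which
      -- leaves a summable cube.
      rw [pow_add]
      gcongr <;> linarith
  calc _ ≤ ∑ n ∈ Finset.range M, B ^ 2 / (N : ℝ) ^ (2 * l)
        * (if n ≤ N then 0 else 2 / (n : ℝ) ^ 3) := Finset.sum_le_sum fun n _ => hterm n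
    _ ≤ B ^ 2 / (N : ℝ) ^ (2 * l) * (1 / (N : ℝ) ^ 2) := by
        rw [← Finset.mul_sum]
        gcongr
        exact sum_two_mul_inv_pow_le N hN M
    _ = _ := by
        rw [show l + 2 - 1 = l + 1 by omega]
        field_simp
        ring

/-- There is ample room: the binomial coefficient, the extra factorial and `√(3(k+1)/(k-1))`, the
product of the two roots, are all at least `1`, and `√π ≤ 2π`. -/
theorem factorial_div_sqrt_pi_le_q₅ {k : ℕ} (hk : 1 < k) : k.factorial * √π / π ≤ q₅ k := by
  have hk1 : (0 : ℝ) < (k : ℝ) - 1 := by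
    have : (1 : ℝ) < k := by exact_mod_cast hk
    linarith
  have hf : (1 : ℝ) ≤ k.factorial := by exact_mod_cast Nat.one_le_of_lt (Nat.factorial_pos k)
  have hc : (1 : ℝ) ≤ k.choose (k / 2) := by
    exact_mod_cast Nat.choose_pos (Nat.div_le_self k 2)
  have hs : 1 ≤ √(3 / (2 * ((k : ℝ) - 1))) * √(2 * ((k : ℝ) + 1)) := by
    rw [← sqrt_mul (by positivity), one_le_sqrt, div_mul_eq_mul_div, le_div_iff₀ (by positivity)]
    linarith
  have hπ : √π ≤ π := by
    rw [sqrt_le_iff]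
    exact ⟨pi_pos.le, by nlinarith [pi_gt_three]⟩
  have e : q₅ k = (2 * π * k.choose (k / 2)) * (√(3 / (2 * ((k : ℝ) - 1))) * √(2 * ((k : ℝ) + 1)))
      * (k.factorial : ℝ) ^ 2 / π := by
    rw [q₅, q₂, q₃, q₄]; ring
  rw [e]
  apply div_le_div_of_nonneg_right _ pi_pos.le
  calc (k.factorial : ℝ) * √π ≤ (k.factorial : ℝ) ^ 2 * (2 * π * 1 * 1) := by
        have : (k.factorial : ℝ) ≤ (k.factorial : ℝ) ^ 2 := by nlinarith
        gcongr
        linarith [pi_pos]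
    _ ≤ (k.factorial : ℝ) ^ 2 * (2 * π * k.choose (k / 2)
          * (√(3 / (2 * ((k : ℝ) - 1))) * √(2 * ((k : ℝ) + 1)))) := by
        gcongr
    _ = _ := by ring

theorem sobolevNorm_nonneg (k : ℕ) (g : ℝ → ℝ) : 0 ≤ sobolevNorm k g :=
  Finset.sum_nonneg fun _ _ => ENNReal.toReal_nonneg

end TailEstimate

end AbelInversion

end

theorem mainTheorem4 (k N : ℕ) (hk : 1 < k) (hN : 1 ≤ N) (f g : ℝ → ℝ)
    (hf : MemLp f 2 (volume.restrict AbelInversion.E))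
    (hfg : g =ᵐ[volume.restrict AbelInversion.E] AbelInversion.abelTransform f)
    (hg : AbelInversion.MemSobolev k g)
    (hg₀ : AbelInversion.VanishesAtZero k g) :
    AbelInversion.normL2 (fun x => f x - AbelInversion.legendrePartialSum f N x) ≤
      AbelInversion.q₅ k * (AbelInversion.sobolevNorm k g / (N : ℝ) ^ (k - 1)) := by
  have hS := AbelInversion.sobolevNorm_nonneg k g
  set S := AbelInversion.sobolevNorm k g
  have hcoef : ∀ n, |AbelInversion.legendreCoeff f n|
      ≤ √(2 * n + 1) * (k.factorial * √Real.pi / Real.pi * S) / ((n : ℝ) + 1 / 2) ^ k := by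
    intro n
    have h1 := AbelInversion.abs_integral_comp_sinSq_mul_sin_le (by omega) hg hg₀ n
    -- `g` equals the Abel transform only almost everywhere; null sets of `E` pull back to null sets
    -- in `t`, so the sine coefficients agree.
    rw [AbelInversion.integral_congr_comp_sinSq hfg
      (fun y t => y * Real.sin (((n : ℝ) + 1 / 2) * t))] at h1
    rw [AbelInversion.legendreCoeff_eq_integral_sin (hf.integrable (by norm_num)) n, abs_mul,
      abs_div, abs_mul, abs_pow, abs_neg, abs_one, one_pow, mul_one,
      abs_of_nonneg (Real.sqrt_nonneg _), abs_of_pos Real.pi_pos]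
    calc _ ≤ √(2 * (n : ℝ) + 1) / Real.pi
          * (k.factorial * (√Real.pi * S) / ((n : ℝ) + 1 / 2) ^ k) := by gcongr
      _ = _ := by ring
  refine (AbelInversion.normL2_sub_partialSum_le hf N (by positivity)
    (AbelInversion.sum_sq_le_of_decay hk hN hcoef)).trans ?_
  rw [← mul_div_assoc]
  gcongr
  exact AbelInversion.factorial_div_sqrt_pi_le_q₅ hk
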